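/- **Setting.** Let $(X_k,Y_k)_{k\ge 1-n}$ be random variables with values in $\mathcal X\times\mathcal Y$ (the pairs with $k\le 0$ form a holdout set), and let $\mathcal F_t=\sigma((X_k,Y_k),\,1-n\le k\le t)$. For $t\ge1$ let $\mathrm{err}_t(y,C)\in[0,1]$ ($y\in\mathcal Y$, $C\subset\mathcal Y$) be an error function with $\mathrm{err}_t(y,\mathcal Y)=0$, $\mathrm{err}_t(y,\emptyset)=1$, and let $S_t(x,q)\in\{0,1\}$ and $\mathcal C_t(x,q)\subset\mathcal Y$ ($x\in\mathcal X$, $q\in\mathbb R$) be a selection rule and a prediction set rule, both (jointly) $\mathcal F_{t-1}$-measurable random functions, such that for some $B>0$ and all $t$, $x$ and $q\ge B$, $\mathcal C_t(x,q)=\mathcal Y$ or $S_t(x,q)=0$. Let $\alpha\in(0,1)$, $c>0$, $\beta\in(1/2,1)$, $\gamma_j=cj^{-\beta}$. The OnlineSCI thresholds are given by $q_1\in[0,B]$ and $$q_{t+1}=q_t+\gamma_{J(t)}\bigl(\mathrm{err}_t(Y_t,\mathcal C_t(X_t,q_t))\mathbf 1\{q_t\ge0\}+\mathbf 1\{q_t<0\}-\alpha\bigr)S_t(X_t,q_t),\qquad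 J(t)=1+\sum_{i=1}^{t-1}S_i(X_i,q_i).$$ The instantaneous error rate is $$\mathrm{IER}_t=\mathbb E[\mathrm{err}_t(Y_t,\mathcal C_t(X_t,q_t))\mid S_t(X_t,q_t)=1,\mathcal F_{t-1}]=\frac{\mathbb E[\mathrm{err}_t(Y_t,\mathcal C_t(X_t,q_t))\,S_t(X_t,q_t)\mid\mathcal F_{t-1}]}{\mathbb E[S_t(X_t,q_t)\mid\mathcal F_{t-1}]}\qquad(0/0=0).$$ **Assumptions.** Let $\Pi^0:[0,B]\to[0,1]$ be deterministic and nonincreasing, with $\Pi^0(q^0_\alpha)=\alpha$ for some $q^0_\alpha\in(0,B)$, continuously differentiable on some $[\ell,u]\subset(0,B)$ with $\ell<q^0_\alpha<u$, and $(\Pi^0)'(q^0_\alpha)<0$. Put $D_t=|\mathrm{IER}_t-\Pi^0(q_t)|\,\mathbf 1\{q_t\in[0,B]\}$. Let $\bar D_t\to0$ be a deterministic sequence, nonincreasing from some time on, and let $\eta_t\in(0,1]$ be nonincreasing with $\log(1/\eta_T)\le\log T$ for all large $T$, such that for some $C_1>0$ and all $t\ge1$, $$\mathbb P(D_t>C_1\bar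 D_t)\le\frac{6\eta_t}{\pi^2t^2}.$$ For deterministic integer sequences $\underline J,\bar J$ put $\omega(t)=1-\mathbb P(\underline J(t)\le J(t)\le\bar J(t))$. Consider one of the following two cases. (i) $\underline J(T)\sim rT$ for some $r>0$, $\bar J(T)=T$, $t(T)=\lfloor rT/2\rfloor$ and $\rho(T)=(\log T)^{1/2}T^{1/2-\beta}+T^{\beta-1}$. (ii) $\bar J$ is nondecreasing from some time on, $t(T)\to\infty$, $t(T)<T$ for large $T$, and with $\Delta(T)=\underline J(T+1)-\bar J(t(T))$ one has $\underline J(T+1)\sim\underline J(t(T))\sim\bar J(T+1)\sim\bar J(t(T))$, $\Delta(T)\sim\bar J(T+1)-\underline J(t(T))$, $\Delta(T)\to\infty$ and $\bar J(T)^\beta\ll\Delta(T)\ll\bar J(T)$; here $\rho(T)=(\log T)^{1/2}\Delta(T)^{1/2}\bar J(T)^{-\beta}+\Delta(T)^{-1}\bar J(T)^{\beta}$. **Conclusion.** (a) There are constants $T_0\ge1$ and $C_0>0$ such that for all $T\ge T_0$ $$\mathbb P\bigl(|\mathrm{IER}_T-\alpha|+|q_T-q^0_\alpha|\le C_0(\rho(T)+\bar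 D_{t(T)})\bigr)\ge1-3\eta'_T-\omega(t(T))-\omega(T+1),$$ where $\eta'_T=\eta_T$ in case (i) and $\eta'_T=\eta_{t(T)}$ in case (ii); in case (ii) one may also take $\eta'_T=\eta_T$ if $T=O(t(T))$. (b) Assume $\bar D_{t(T)}=O(\rho(T)+\bar D_T)$ and, in case (ii), $T=O(t(T))$. Then there are constants $T_0\ge1$ and $C_0>0$ such that for all $T\ge T_0$ $$\mathbb P\bigl(|\mathrm{IER}_T-\alpha|+|q_T-q^0_\alpha|\le C_0(\rho(T)+\bar D_T)\bigr)\ge1-3\eta_T-\omega(t(T))-\omega(T+1).$$ All constants $T_0,C_0$ may depend on everything except $T$. -/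

import Mathlib

open MeasureTheory Filter Asymptotics

namespace OnlineSCI

/-- A data stream `(X_k, Y_k)`: the pairs with `1 - n ≤ k ≤ 0` form the holdout set of size `n`,
the pairs with `k ≥ 1` arrive one after the other. The indices `k < 1 - n` are never used. -/
structure DataStream (Ω 𝒳 𝒴 : Type*) [MeasurableSpace Ω] [MeasurableSpace 𝒳]
    [MeasurableSpace 𝒴] where
  n : ℕ
  X : ℤ → Ω → 𝒳
  Y : ℤ → Ω → 𝒴
  measurable_X : ∀ k, 1 - (n : ℤ) ≤ k → Measurable (X k)
  measurable_Y : ∀ k, 1 - (n : ℤ) ≤ k → Measurable (Y k)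

/-- The σ-algebra `𝓕_t` generated by the holdout set and by `(X_k, Y_k)`, `1 ≤ k ≤ t`. -/
abbrev DataStream.past {Ω 𝒳 𝒴 : Type*} [MeasurableSpace Ω] [MeasurableSpace 𝒳]
    [MeasurableSpace 𝒴] (P : DataStream Ω 𝒳 𝒴) (t : ℤ) : MeasurableSpace Ω :=
  ⨆ k ∈ Set.Icc (1 - (P.n : ℤ)) t,
    MeasurableSpace.comap (fun ω => (P.X k ω, P.Y k ω)) inferInstance

/-- Error functions, selection rules and prediction set rules, at the times `t ≥ 1`.
The rules at time `t` are `𝓕_{t-1}`-measurable random functions of `(x, q)`; the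
measurability of the set-valued rule is that of the errors it makes. -/
structure Rules {Ω 𝒳 𝒴 : Type*} [MeasurableSpace Ω] [MeasurableSpace 𝒳] [MeasurableSpace 𝒴]
    (P : DataStream Ω 𝒳 𝒴) where
  /-- `err_t(y, C)` -/
  err : ℕ → 𝒴 → Set 𝒴 → ℝ
  /-- `S_t(x, q)` -/
  sel : ℕ → Ω → 𝒳 → ℝ → ℕ
  /-- `𝒞_t(x, q)` -/
  predSet : ℕ → Ω → 𝒳 → ℝ → Set 𝒴
  B : ℝ
  B_pos : 0 < B
  err_mem : ∀ t, 1 ≤ t → ∀ y C, err t y C ∈ Set.Icc (0 : ℝ) 1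
  err_univ : ∀ t, 1 ≤ t → ∀ y, err t y Set.univ = 0
  err_empty : ∀ t, 1 ≤ t → ∀ y, err t y ∅ = 1
  sel_zero_or_one : ∀ t, 1 ≤ t → ∀ ω x q, sel t ω x q = 0 ∨ sel t ω x q = 1
  above_B : ∀ t, 1 ≤ t → ∀ ω x q, B ≤ q → predSet t ω x q = Set.univ ∨ sel t ω x q = 0
  measurable_sel : ∀ t : ℕ, 1 ≤ t →
    Measurable[(P.past ((t : ℤ) - 1)).prod (inferInstance : MeasurableSpace (𝒳 × ℝ))]
      (fun z : Ω × 𝒳 × ℝ => sel t z.1 z.2.1 z.2.2)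
  measurable_err : ∀ t : ℕ, 1 ≤ t →
    Measurable[(P.past ((t : ℤ) - 1)).prod (inferInstance : MeasurableSpace (𝒳 × ℝ × 𝒴))]
      (fun z : Ω × 𝒳 × ℝ × 𝒴 => err t z.2.2.2 (predSet t z.1 z.2.1 z.2.2.1))

section Procedure

variable {Ω 𝒳 𝒴 : Type*} [MeasurableSpace Ω] [MeasurableSpace 𝒳] [MeasurableSpace 𝒴]
  {P : DataStream Ω 𝒳 𝒴}

/-- `react_t(y, C, q) = err_t(y, C) 1{q ≥ 0} + 1{q < 0}`. -/
noncomputable def react (R : Rules P) (t : ℕ) (y : 𝒴) (C : Set 𝒴) (q : ℝ) : ℝ :=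
  if 0 ≤ q then R.err t y C else 1

/-- The pair `(q_{t+1}, J(t+1))` of threshold and selection number after `t` steps. -/
noncomputable def state (R : Rules P) (γ : ℕ → ℝ) (α q₁ : ℝ) : ℕ → Ω → ℝ × ℕ
  | 0, _ => (q₁, 1)
  | t + 1, ω =>
    let q := (state R γ α q₁ t ω).1
    let j := (state R γ α q₁ t ω).2
    let x := P.X ((t + 1 : ℕ) : ℤ) ω
    let y := P.Y ((t + 1 : ℕ) : ℤ) ω
    (q + γ j * (react R (t + 1) y (R.predSet (t + 1) ω x q) q - α) * R.sel (t + 1) ω x q,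
      j + R.sel (t + 1) ω x q)

/-- The OnlineSCI threshold `q_t`, for `t ≥ 1`. -/
noncomputable def threshold (R : Rules P) (γ : ℕ → ℝ) (α q₁ : ℝ) (t : ℕ) (ω : Ω) : ℝ :=
  (state R γ α q₁ (t - 1) ω).1

/-- `J(t) = ∑_{1 ≤ i < t} S_i(X_i, q_i) + 1`. -/
noncomputable def selNumber (R : Rules P) (γ : ℕ → ℝ) (α q₁ : ℝ) (t : ℕ) (ω : Ω) : ℕ :=
  ∑ i ∈ Finset.Ico 1 t, R.sel i ω (P.X i ω) (threshold R γ α q₁ i ω) + 1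

theorem state_snd (R : Rules P) (γ : ℕ → ℝ) (α q₁ : ℝ) (t : ℕ) (ω : Ω) :
    (state R γ α q₁ t ω).2 = selNumber R γ α q₁ (t + 1) ω := by
  induction t with
  | zero => simp [state, selNumber]
  | succ t ih =>
    rw [selNumber, Finset.sum_Ico_succ_top (by omega)]
    rw [selNumber] at ih
    simp only [state, ih, threshold, Nat.add_sub_cancel]
    ring

theorem threshold_one (R : Rules P) (γ : ℕ → ℝ) (α q₁ : ℝ) (ω : Ω) :
    threshold R γ α q₁ 1 ω = q₁ := rfl

/-- The defining recursion of OnlineSCI. -/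
theorem threshold_succ (R : Rules P) (γ : ℕ → ℝ) (α q₁ : ℝ) (t : ℕ) (ht : 1 ≤ t) (ω : Ω) :
    threshold R γ α q₁ (t + 1) ω = threshold R γ α q₁ t ω
      + γ (selNumber R γ α q₁ t ω)
        * (react R t (P.Y t ω) (R.predSet t ω (P.X t ω) (threshold R γ α q₁ t ω))
            (threshold R γ α q₁ t ω) - α)
        * R.sel t ω (P.X t ω) (threshold R γ α q₁ t ω) := by
  obtain ⟨s, rfl⟩ : ∃ s, t = s + 1 := ⟨t - 1, by omega⟩
  rw [← state_snd]
  rfl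

/-- `Π_{𝒞_t,S_t}(q) = E[err_t(Y_t, 𝒞_t(X_t, q)) | S_t(X_t, q) = 1, 𝓕_{t-1}]`, for a threshold `q`
that is a constant or, more generally, an `𝓕_{t-1}`-measurable random variable. It is `0` where
the conditional probability of selection vanishes. -/
noncomputable def condError (μ : Measure Ω) (R : Rules P) (t : ℕ) (q : Ω → ℝ) (ω : Ω) : ℝ :=
  (μ[fun ω' => R.err t (P.Y t ω') (R.predSet t ω' (P.X t ω') (q ω'))
      * (R.sel t ω' (P.X t ω') (q ω') : ℝ) | P.past ((t : ℤ) - 1)]) ω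
    / (μ[fun ω' => (R.sel t ω' (P.X t ω') (q ω') : ℝ) | P.past ((t : ℤ) - 1)]) ω

/-- The instantaneous error rate of OnlineSCI at time `t`. -/
noncomputable def ier (μ : Measure Ω) (R : Rules P) (γ : ℕ → ℝ) (α q₁ : ℝ) (t : ℕ) (ω : Ω) : ℝ :=
  condError μ R t (threshold R γ α q₁ t) ω

open Classical in
/-- `D_t = |Π_{𝒞_t,S_t}(q_t) - Π⁰(q_t)| 1{q_t ∈ [0, B]}`. -/
noncomputable def benchDist (μ : Measure Ω) (R : Rules P) (γ : ℕ → ℝ) (α q₁ : ℝ) (Pi0 : ℝ → ℝ)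
    (t : ℕ) (ω : Ω) : ℝ :=
  if threshold R γ α q₁ t ω ∈ Set.Icc 0 R.B then
    |condError μ R t (threshold R γ α q₁ t) ω - Pi0 (threshold R γ α q₁ t ω)|
  else 0

/-- `ω(t) = 1 - P(Jlow(t) ≤ J(t) ≤ Jup(t))`. -/
noncomputable def bracketFailure (μ : Measure Ω) (R : Rules P) (γ : ℕ → ℝ) (α q₁ : ℝ)
    (Jlow Jup : ℕ → ℤ) (t : ℕ) : ℝ :=
  1 - μ.real {ω | Jlow t ≤ (selNumber R γ α q₁ t ω : ℤ) ∧ (selNumber R γ α q₁ t ω : ℤ) ≤ Jup t}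

/-- There are constants `T₀ ≥ 1` and `C₀ > 0` such that for all `T ≥ T₀`, with probability at least
`1 - 3 η_T - ω(t(T)) - ω(T+1)`, one has `|IER_T - α| + |q_T - q₀| ≤ C₀ rate(T)`. -/
def HasRate (μ : Measure Ω) (R : Rules P) (γ : ℕ → ℝ) (α q₁ q₀ : ℝ) (Jlow Jup : ℕ → ℤ)
    (tT : ℕ → ℕ) (η rate : ℕ → ℝ) : Prop :=
  ∃ T₀ : ℕ, ∃ C₀ : ℝ, 1 ≤ T₀ ∧ 0 < C₀ ∧ ∀ T : ℕ, T₀ ≤ T →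
    1 - 3 * η T - bracketFailure μ R γ α q₁ Jlow Jup (tT T)
        - bracketFailure μ R γ α q₁ Jlow Jup (T + 1)
      ≤ μ.real {ω | |ier μ R γ α q₁ T ω - α| + |threshold R γ α q₁ T ω - q₀| ≤ C₀ * rate T}

end Procedure

/-- The regularity assumption on the benchmark function `Π⁰ : [0, B] → [0, 1]` with
`Π⁰(q₀) = α`. -/
structure IsBenchmark (B α q₀ : ℝ) (Pi0 : ℝ → ℝ) : Prop where
  mem_unit : ∀ q ∈ Set.Icc 0 B, Pi0 q ∈ Set.Icc (0 : ℝ) 1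
  q₀_mem : q₀ ∈ Set.Ioo 0 B
  value : Pi0 q₀ = α
  antitone : AntitoneOn Pi0 (Set.Icc 0 B)
  smooth : ∃ l u : ℝ, 0 < l ∧ l < q₀ ∧ q₀ < u ∧ u < B ∧ ContDiffOn ℝ 1 Pi0 (Set.Icc l u)
  deriv_neg : deriv Pi0 q₀ < 0

/-- The step sequence `γ_j = c j^{-β}`. -/
noncomputable def step (c β : ℝ) (j : ℕ) : ℝ := c * (j : ℝ) ^ (-β)

/-- `(log T)^{1/2} T^{1/2-β} + T^{β-1}`. -/
noncomputable def rhoLinear (β : ℝ) (T : ℕ) : ℝ :=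
  Real.sqrt (Real.log T) * (T : ℝ) ^ (1 / 2 - β) + (T : ℝ) ^ (β - 1)

/-- `Δ(T) = Jlow(T+1) - Jup(t(T))`. -/
def gap (Jlow Jup : ℕ → ℤ) (tT : ℕ → ℕ) (T : ℕ) : ℝ := ((Jlow (T + 1) - Jup (tT T) : ℤ) : ℝ)

/-- `(log T)^{1/2} Δ(T)^{1/2} Jup(T)^{-β} + Δ(T)^{-1} Jup(T)^β`. -/
noncomputable def rhoConc (β : ℝ) (Jlow Jup : ℕ → ℤ) (tT : ℕ → ℕ) (T : ℕ) : ℝ :=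
  Real.sqrt (Real.log T) * Real.sqrt (gap Jlow Jup tT T) * (Jup T : ℝ) ^ (-β)
    + (gap Jlow Jup tT T)⁻¹ * (Jup T : ℝ) ^ β

/-- The regime of concentration of the selection number. -/
structure IsConcRegime (β : ℝ) (Jlow Jup : ℕ → ℤ) (tT : ℕ → ℕ) : Prop where
  mono_up : ∀ᶠ t in atTop, Jup t ≤ Jup (t + 1)
  time_lt : ∀ᶠ T in atTop, tT T < T
  time_tendsto : Tendsto tT atTop atTop
  low_low : (fun T : ℕ => (Jlow (T + 1) : ℝ)) ~[atTop] (fun T => (Jlow (tT T) : ℝ))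
  low_up : (fun T : ℕ => (Jlow (tT T) : ℝ)) ~[atTop] (fun T => (Jup (T + 1) : ℝ))
  up_up : (fun T : ℕ => (Jup (T + 1) : ℝ)) ~[atTop] (fun T => (Jup (tT T) : ℝ))
  gap_equiv : gap Jlow Jup tT ~[atTop] (fun T => (Jup (T + 1) : ℝ) - (Jlow (tT T) : ℝ))
  gap_tendsto : Tendsto (gap Jlow Jup tT) atTop atTop
  pow_lt_gap : (fun T : ℕ => (Jup T : ℝ) ^ β) =o[atTop] gap Jlow Jup tT
  gap_lt_up : gap Jlow Jup tT =o[atTop] (fun T : ℕ => (Jup T : ℝ))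

end OnlineSCI

namespace OnlineSCI

theorem exp_le_add_exp_sq (x : ℝ) : Real.exp x ≤ x + Real.exp (x ^ 2) := by
  have h2 := Real.add_one_le_exp (x ^ 2)
  rcases le_or_gt |x| 1 with hx | hx
  · have h := Real.abs_exp_sub_one_sub_id_le hx
    have := (abs_le.mp h).2
    linarith
  · rcases lt_abs.mp hx with h | h
    · have : Real.exp x ≤ Real.exp (x ^ 2) := Real.exp_le_exp.mpr (by nlinarith)
      linarith
    · have : Real.exp x ≤ 1 := Real.exp_le_one_iff.mpr (by linarith)
      nlinarith

theorem exp_sub_sq_le {x g : ℝ} (hx : |x| ≤ |g|) :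
    Real.exp (x - g ^ 2) ≤ 1 + x * Real.exp (-g ^ 2) := by
  have h1 : Real.exp (x ^ 2) ≤ Real.exp (g ^ 2) := Real.exp_le_exp.mpr (sq_le_sq.mpr hx)
  have h2 := exp_le_add_exp_sq x
  have h3 : Real.exp (g ^ 2) * Real.exp (-g ^ 2) = 1 := by rw [← Real.exp_add]; simp
  have h4 := Real.exp_pos (-g ^ 2)
  rw [sub_eq_add_neg, Real.exp_add]
  have : Real.exp x * Real.exp (-g ^ 2) ≤ (x + Real.exp (g ^ 2)) * Real.exp (-g ^ 2) :=
    mul_le_mul_of_nonneg_right (by linarith) h4.le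
  linarith

/-- Excursion argument: a sequence that is pushed down by `θ w t` up to the noise `ξ t` whenever it
exceeds `ε` ends below `ε`, up to one step and the noise, if the total push exceeds its range. -/
theorem le_of_drift {x w ξ : ℕ → ℝ} {t₀ T : ℕ} {ε b a M θ : ℝ} (hT : t₀ ≤ T)
    (hε : 0 ≤ ε) (hb : 0 ≤ b) (ha : 0 ≤ a) (hw : ∀ t, 0 ≤ w t) (hθ : 0 ≤ θ)
    (hstep : ∀ t, t₀ ≤ t → t < T → x (t + 1) ≤ x t + b)
    (hdrift : ∀ t, t₀ ≤ t → t < T → ε < x t → x (t + 1) ≤ x t + ξ t - θ * w t)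
    (hξ : ∀ s, t₀ ≤ s → s ≤ T → ∑ t ∈ Finset.Ico s T, ξ t ≤ a)
    (hM : x t₀ ≤ M) (hpush : M ≤ θ * ∑ t ∈ Finset.Ico t₀ T, w t) :
    x T ≤ ε + b + a := by
  have key : ∀ s, t₀ ≤ s → s ≤ T → (∀ t, s ≤ t → t < T → ε < x t) →
      x T ≤ x s + ∑ t ∈ Finset.Ico s T, ξ t - θ * ∑ t ∈ Finset.Ico s T, w t := by
    intro s hs hsT habove
    rw [Finset.mul_sum]
    have : ∑ t ∈ Finset.Ico s T, (x (t + 1) - x t) ≤ ∑ t ∈ Finset.Ico s T, (ξ t - θ * w t) := by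
      apply Finset.sum_le_sum
      intro t ht
      rw [Finset.mem_Ico] at ht
      have := hdrift t (hs.trans ht.1) ht.2 (habove t ht.1 ht.2)
      linarith
    rw [Finset.sum_Ico_sub x hsT, Finset.sum_sub_distrib] at this
    linarith
  by_cases hex : ∃ s, s ≤ T ∧ t₀ ≤ s ∧ x s ≤ ε
  · obtain ⟨s, hsT, ⟨hs, hxs⟩, hmax⟩ : ∃ s, s ≤ T ∧ (t₀ ≤ s ∧ x s ≤ ε) ∧
        ∀ t, s < t → t ≤ T → ¬(t₀ ≤ t ∧ x t ≤ ε) := by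
      classical
      obtain ⟨s, hsT, hs⟩ := hex
      refine ⟨Nat.findGreatest (fun s => t₀ ≤ s ∧ x s ≤ ε) T, Nat.findGreatest_le _,
        Nat.findGreatest_spec (P := fun s => t₀ ≤ s ∧ x s ≤ ε) hsT hs, ?_⟩
      intro t h1 h2
      exact Nat.findGreatest_is_greatest h1 h2
    rcases hsT.eq_or_lt with rfl | hlt
    · linarith
    · have h1 := key (s + 1) (by omega) (by omega) (by
        intro t h1 h2
        have := hmax t (by omega) h2.le
        push Not at this
        exact this (by omega))
      have h2 := hξ (s + 1) (by omega) (by omega)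
      have h3 := hstep s hs hlt
      have h4 : 0 ≤ θ * ∑ t ∈ Finset.Ico (s + 1) T, w t :=
        mul_nonneg hθ (Finset.sum_nonneg fun t _ => hw t)
      linarith
  · push Not at hex
    have h1 := key t₀ le_rfl hT (fun t h1 h2 => hex t h2.le h1)
    have h2 := hξ t₀ le_rfl hT
    linarith

section Deviation

variable {Ω : Type*} {m0 : MeasurableSpace Ω} {μ : Measure Ω}

theorem integrable_of_abs_le [IsFiniteMeasure μ] {f : Ω → ℝ} {K : ℝ} (hf : Measurable f)
    (hK : ∀ ω, |f ω| ≤ K) :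
    Integrable f μ :=
  Integrable.of_bound hf.aestronglyMeasurable K (ae_of_all _ hK)

/-- Predictable weights `g`, increments `d` dominated by the indicator `s` and orthogonal to the
past: the hypotheses of the deviation inequality. -/
structure IsSelectedNoise (μ : Measure Ω) (ℱ : ℕ → MeasurableSpace Ω) (g d s : ℕ → Ω → ℝ)
    (a : ℕ) (K : ℝ) : Prop where
  le : ∀ t, ℱ t ≤ m0
  mono : Monotone ℱ
  meas_g : ∀ t, a ≤ t → Measurable[ℱ t] (g t)
  meas_d : ∀ t, a ≤ t → Measurable[ℱ (t + 1)] (d t)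
  meas_s : ∀ t, a ≤ t → Measurable[ℱ (t + 1)] (s t)
  abs_g : ∀ t, a ≤ t → ∀ ω, |g t ω| ≤ K
  s_mem : ∀ t, a ≤ t → ∀ ω, s t ω = 0 ∨ s t ω = 1
  abs_d : ∀ t, a ≤ t → ∀ ω, |d t ω| ≤ s t ω
  centered : ∀ t, a ≤ t → ∀ W : Ω → ℝ, Measurable[ℱ t] W → (∃ C, ∀ ω, |W ω| ≤ C) →
    ∫ ω, W ω * d t ω ∂μ = 0

variable {ℱ : ℕ → MeasurableSpace Ω} {g d s : ℕ → Ω → ℝ} {a : ℕ} {K : ℝ}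

/-- The compensated exponential of the weighted noise between the times `a` and `n`. -/
noncomputable def expNoise (g d s : ℕ → Ω → ℝ) (lam : ℝ) (a n : ℕ) (ω : Ω) : ℝ :=
  Real.exp (∑ t ∈ Finset.Ico a n, (lam * g t ω * d t ω - (lam * g t ω) ^ 2 * s t ω))

theorem IsSelectedNoise.measurable_expNoise (h : IsSelectedNoise μ ℱ g d s a K) (lam : ℝ)
    (n : ℕ) : Measurable[ℱ n] (expNoise g d s lam a n) := by
  refine Real.measurable_exp.comp (Finset.measurable_sum _ fun t ht => ?_)
  rw [Finset.mem_Ico] at ht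
  have hg : Measurable[ℱ n] (g t) := (h.meas_g t ht.1).mono (h.mono ht.2.le) le_rfl
  have hd : Measurable[ℱ n] (d t) := (h.meas_d t ht.1).mono (h.mono ht.2) le_rfl
  have hs : Measurable[ℱ n] (s t) := (h.meas_s t ht.1).mono (h.mono ht.2) le_rfl
  exact ((hg.const_mul lam).mul hd).sub (((hg.const_mul lam).pow_const 2).mul hs)

theorem IsSelectedNoise.expNoise_le (h : IsSelectedNoise μ ℱ g d s a K) (lam : ℝ)
    (n : ℕ) (ω : Ω) : |expNoise g d s lam a n ω| ≤ Real.exp ((n - a : ℕ) * (|lam| * K)) := by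
  rw [expNoise, abs_of_pos (Real.exp_pos _), Real.exp_le_exp]
  refine (Finset.sum_le_card_nsmul _ _ (|lam| * K) fun t ht => ?_).trans (by simp)
  rw [Finset.mem_Ico] at ht
  have h1 := h.abs_g t ht.1 ω
  have h2 := h.abs_d t ht.1 ω
  have h3 : |d t ω| ≤ 1 ∧ 0 ≤ s t ω := by
    rcases h.s_mem t ht.1 ω with h | h <;> rw [h] at h2 ⊢ <;> constructor <;> linarith
  have h4 : lam * g t ω * d t ω ≤ |lam| * K * 1 := by
    refine (le_abs_self _).trans ?_
    rw [abs_mul, abs_mul]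
    have hK : 0 ≤ K := (abs_nonneg _).trans h1
    gcongr
    exact h3.1
  have h5 : 0 ≤ (lam * g t ω) ^ 2 * s t ω := mul_nonneg (sq_nonneg _) h3.2
  linarith

variable [IsProbabilityMeasure μ]

theorem IsSelectedNoise.integral_expNoise_le (h : IsSelectedNoise μ ℱ g d s a K) (lam : ℝ)
    (n : ℕ) (hn : a ≤ n) : ∫ ω, expNoise g d s lam a n ω ∂μ ≤ 1 := by
  induction n, hn using Nat.le_induction with
  | base => simp [expNoise]
  | succ n hn ih =>
    have hintegrable : ∀ k, Integrable (expNoise g d s lam a k) μ := fun k =>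
      integrable_of_abs_le ((h.measurable_expNoise lam k).mono (h.le k) le_rfl)
        (h.expNoise_le lam k)
    set W : Ω → ℝ := fun ω =>
      expNoise g d s lam a n ω * (lam * g n ω * Real.exp (-(lam * g n ω) ^ 2)) with hW
    have hWmeas : Measurable[ℱ n] W := by
      have hg : Measurable[ℱ n] (fun ω => lam * g n ω) := (h.meas_g n hn).const_mul lam
      exact (h.measurable_expNoise lam n).mul
        (hg.mul (Real.measurable_exp.comp (hg.pow_const 2).neg))
    have hWb : ∀ ω, |W ω| ≤ Real.exp ((n - a : ℕ) * (|lam| * K)) * (|lam| * K * 1) := by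
      intro ω
      rw [hW, abs_mul, abs_mul, abs_mul]
      have h1 := h.abs_g n hn ω
      have hK : 0 ≤ K := (abs_nonneg _).trans h1
      gcongr
      · exact h.expNoise_le lam n ω
      · rw [abs_of_pos (Real.exp_pos _), Real.exp_le_one_iff]
        nlinarith [sq_nonneg (lam * g n ω)]
    have hd1 : ∀ ω, |d n ω| ≤ 1 := fun ω => (h.abs_d n hn ω).trans (by
      rcases h.s_mem n hn ω with h | h <;> simp [h])
    have hWd : Integrable (fun ω => W ω * d n ω) μ := by
      refine integrable_of_abs_le (K := Real.exp ((n - a : ℕ) * (|lam| * K)) * (|lam| * K * 1) * 1)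
        ((hWmeas.mono (h.le n) le_rfl).mul ((h.meas_d n hn).mono (h.le _) le_rfl)) fun ω => ?_
      rw [abs_mul]
      exact mul_le_mul (hWb ω) (hd1 ω) (abs_nonneg _) ((abs_nonneg _).trans (hWb ω))
    have hle : ∀ ω, expNoise g d s lam a (n + 1) ω
        ≤ expNoise g d s lam a n ω + W ω * d n ω := by
      intro ω
      rw [expNoise, Finset.sum_Ico_succ_top hn, Real.exp_add, ← expNoise]
      have hpos : 0 < expNoise g d s lam a n ω := Real.exp_pos _
      have h2 := h.abs_d n hn ω
      have : Real.exp (lam * g n ω * d n ω - (lam * g n ω) ^ 2 * s n ω)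
          ≤ 1 + lam * g n ω * d n ω * Real.exp (-(lam * g n ω) ^ 2) := by
        rcases h.s_mem n hn ω with h0 | h0 <;> rw [h0] at h2 ⊢
        · rw [abs_nonpos_iff.mp h2]; simp
        · rw [mul_one]
          apply exp_sub_sq_le
          rw [abs_mul]
          exact mul_le_of_le_one_right (abs_nonneg _) h2
      calc _ ≤ expNoise g d s lam a n ω
            * (1 + lam * g n ω * d n ω * Real.exp (-(lam * g n ω) ^ 2)) := by gcongr
        _ = _ := by rw [hW]; ring
    calc ∫ ω, expNoise g d s lam a (n + 1) ω ∂μ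
        ≤ ∫ ω, (expNoise g d s lam a n ω + W ω * d n ω) ∂μ :=
          integral_mono (hintegrable _) ((hintegrable n).add hWd) hle
      _ = ∫ ω, expNoise g d s lam a n ω ∂μ + 0 := by
          rw [integral_add (hintegrable n) hWd, h.centered n hn W hWmeas ⟨_, hWb⟩]
      _ ≤ 1 := by linarith

theorem IsSelectedNoise.measure_le_exp (h : IsSelectedNoise μ ℱ g d s a K) {lam : ℝ}
    {n : ℕ} (hn : a ≤ n) {A V : ℝ} :
    μ.real {ω | A ≤ lam * ∑ t ∈ Finset.Ico a n, g t ω * d t ω ∧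
        ∑ t ∈ Finset.Ico a n, (g t ω) ^ 2 * s t ω ≤ V} ≤ Real.exp (lam ^ 2 * V - A) := by
  have hintegrable : Integrable (expNoise g d s lam a n) μ :=
    integrable_of_abs_le ((h.measurable_expNoise lam n).mono (h.le n) le_rfl)
      (h.expNoise_le lam n)
  have hmarkov := mul_meas_ge_le_integral_of_nonneg (μ := μ)
    (ae_of_all _ fun ω => (Real.exp_pos _).le) hintegrable (Real.exp (A - lam ^ 2 * V))
  have hsub : {ω | A ≤ lam * ∑ t ∈ Finset.Ico a n, g t ω * d t ω ∧
        ∑ t ∈ Finset.Ico a n, (g t ω) ^ 2 * s t ω ≤ V}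
      ⊆ {ω | Real.exp (A - lam ^ 2 * V) ≤ expNoise g d s lam a n ω} := by
    rintro ω ⟨h1, h2⟩
    rw [Set.mem_ofPred_eq, expNoise, Real.exp_le_exp, Finset.sum_sub_distrib]
    have h3 : ∑ t ∈ Finset.Ico a n, lam * g t ω * d t ω
        = lam * ∑ t ∈ Finset.Ico a n, g t ω * d t ω := by
      rw [Finset.mul_sum]; exact Finset.sum_congr rfl fun _ _ => by ring
    have h4 : ∑ t ∈ Finset.Ico a n, (lam * g t ω) ^ 2 * s t ω
        = lam ^ 2 * ∑ t ∈ Finset.Ico a n, (g t ω) ^ 2 * s t ω := by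
      rw [Finset.mul_sum]; exact Finset.sum_congr rfl fun _ _ => by ring
    rw [h3, h4]
    have := mul_le_mul_of_nonneg_left h2 (sq_nonneg lam)
    linarith
  have h1 := h.integral_expNoise_le lam n hn
  have h2 : μ.real {ω | A ≤ lam * ∑ t ∈ Finset.Ico a n, g t ω * d t ω ∧
        ∑ t ∈ Finset.Ico a n, (g t ω) ^ 2 * s t ω ≤ V}
      ≤ μ.real {ω | Real.exp (A - lam ^ 2 * V) ≤ expNoise g d s lam a n ω} :=
    measureReal_mono hsub
  have h3 : Real.exp (lam ^ 2 * V - A) * Real.exp (A - lam ^ 2 * V) = 1 := by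
    rw [← Real.exp_add]; simp
  have h4 := Real.exp_pos (lam ^ 2 * V - A)
  calc _ ≤ _ := h2
    _ = Real.exp (lam ^ 2 * V - A) * (Real.exp (A - lam ^ 2 * V) *
        μ.real {ω | Real.exp (A - lam ^ 2 * V) ≤ expNoise g d s lam a n ω}) := by
        rw [← mul_assoc, h3, one_mul]
    _ ≤ Real.exp (lam ^ 2 * V - A) * 1 := by gcongr; exact hmarkov.trans h1
    _ = _ := mul_one _

/-- Two-sided deviation inequality for the weighted noise, on the event that the sum of the squared
weights at the selected times is at most `V`. -/
theorem IsSelectedNoise.measure_abs_le_exp (h : IsSelectedNoise μ ℱ g d s a K)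
    {n : ℕ} (hn : a ≤ n) {V L : ℝ} (hV : 0 < V) (hL : 0 ≤ L) :
    μ.real {ω | 2 * Real.sqrt (L * V) < |∑ t ∈ Finset.Ico a n, g t ω * d t ω| ∧
        ∑ t ∈ Finset.Ico a n, (g t ω) ^ 2 * s t ω ≤ V} ≤ 2 * Real.exp (-L) := by
  have hlam : Real.sqrt (L / V) ^ 2 * V - 2 * L = -L := by
    rw [Real.sq_sqrt (by positivity)]; field_simp; ring
  have hprod : Real.sqrt (L / V) * (2 * Real.sqrt (L * V)) = 2 * L := by
    rw [mul_left_comm, ← Real.sqrt_mul (by positivity)]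
    have : L / V * (L * V) = L ^ 2 := by field_simp
    rw [this, Real.sqrt_sq hL]
  have h1 := h.measure_le_exp (lam := Real.sqrt (L / V)) hn (A := 2 * L) (V := V)
  have h2 := h.measure_le_exp (lam := -Real.sqrt (L / V)) hn (A := 2 * L) (V := V)
  rw [neg_sq, hlam] at h2
  rw [hlam] at h1
  rw [two_mul (Real.exp _)]
  refine (measureReal_mono ?_).trans ((measureReal_union_le _ _).trans (add_le_add h1 h2))
  rintro ω ⟨h3, h4⟩
  have h0 := Real.sqrt_nonneg (L / V)
  rcases lt_abs.mp h3 with h5 | h5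
  · left
    refine ⟨?_, h4⟩
    rw [← hprod]
    gcongr
  · right
    refine ⟨?_, h4⟩
    rw [← hprod, neg_mul, ← mul_neg]
    gcongr

end Deviation

end OnlineSCI

namespace OnlineSCI

section CondRatio

variable {Ω : Type*} {m m0 : MeasurableSpace Ω} {μ : Measure Ω} {f h : Ω → ℝ}

theorem condExp_ratio_mem (hf : Integrable f μ) (hh : Integrable h μ)
    (h0 : ∀ ω, 0 ≤ f ω) (hfh : ∀ ω, f ω ≤ h ω) :
    ∀ᵐ ω ∂μ, (μ[f | m]) ω / (μ[h | m]) ω ∈ Set.Icc (0 : ℝ) 1 ∧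
      (μ[f | m]) ω / (μ[h | m]) ω * (μ[h | m]) ω = (μ[f | m]) ω := by
  have h1 : 0 ≤ᵐ[μ] μ[f | m] := condExp_nonneg (ae_of_all _ h0)
  have h2 : μ[f | m] ≤ᵐ[μ] μ[h | m] := condExp_mono hf hh (ae_of_all _ hfh)
  filter_upwards [h1, h2] with ω h1 h2
  have h1' : 0 ≤ (μ[f | m]) ω := h1
  have h3 := h1'.trans h2
  refine ⟨⟨div_nonneg h1' h3, div_le_one_of_le₀ h2 h3⟩, ?_⟩
  by_cases hz : (μ[h | m]) ω = 0
  · rw [hz, mul_zero]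
    exact le_antisymm h1' (hz ▸ h2)
  · exact div_mul_cancel₀ _ hz

variable [IsProbabilityMeasure μ]

theorem integral_mul_condExp (hm : m ≤ m0) (hf : Integrable f μ) {W : Ω → ℝ}
    (hW : Measurable[m] W) {C : ℝ} (hC : ∀ ω, |W ω| ≤ C) :
    ∫ ω, W ω * f ω ∂μ = ∫ ω, W ω * (μ[f | m]) ω ∂μ := by
  have hWf : Integrable (W * f) μ :=
    hf.bdd_mul (hW.mono hm le_rfl).aestronglyMeasurable (ae_of_all _ hC)
  have h1 := condExp_mul_of_stronglyMeasurable_left (μ := μ) hW.stronglyMeasurable hWf hf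
  have h2 : ∫ ω, (W * f) ω ∂μ = ∫ ω, (μ[W * f | m]) ω ∂μ := (integral_condExp hm).symm
  exact h2.trans (integral_congr_ae h1)

/-- Subtracting from `f` the truncated ratio of the conditional expectations of `f` and `h`, times
`h`, gives a variable that is orthogonal to the conditioning σ-algebra. -/
theorem integral_mul_sub_condExp_ratio (hm : m ≤ m0) (hf : Integrable f μ) (hh : Integrable h μ)
    (h0 : ∀ ω, 0 ≤ f ω) (hfh : ∀ ω, f ω ≤ h ω) {p : Ω → ℝ} (hp : Measurable[m] p)
    (hp01 : ∀ ω, p ω ∈ Set.Icc (0 : ℝ) 1)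
    (hpeq : ∀ᵐ ω ∂μ, (μ[f | m]) ω / (μ[h | m]) ω = p ω) {W : Ω → ℝ}
    (hW : Measurable[m] W) {C : ℝ} (hC : ∀ ω, |W ω| ≤ C) :
    ∫ ω, W ω * (f ω - p ω * h ω) ∂μ = 0 := by
  have hpabs : ∀ ω, |p ω| ≤ 1 := fun ω => abs_le.mpr ⟨by linarith [(hp01 ω).1], (hp01 ω).2⟩
  have hWp : ∀ ω, |W ω * p ω| ≤ C * 1 := fun ω => by
    rw [abs_mul]
    exact mul_le_mul (hC ω) (hpabs ω) (abs_nonneg _) ((abs_nonneg _).trans (hC ω))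
  have hWf : Integrable (fun ω => W ω * f ω) μ :=
    hf.bdd_mul (hW.mono hm le_rfl).aestronglyMeasurable (ae_of_all _ hC)
  have hWph : Integrable (fun ω => W ω * p ω * h ω) μ :=
    hh.bdd_mul ((hW.mul hp).mono hm le_rfl).aestronglyMeasurable (ae_of_all _ hWp)
  have e : ∀ ω, W ω * (f ω - p ω * h ω) = W ω * f ω - W ω * p ω * h ω := fun ω => by ring
  simp_rw [e]
  rw [integral_sub hWf hWph, integral_mul_condExp hm hf hW hC,
    integral_mul_condExp hm hh (W := fun ω => W ω * p ω) (hW.mul hp) hWp, sub_eq_zero]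
  refine integral_congr_ae ?_
  filter_upwards [condExp_ratio_mem (m := m) hf hh h0 hfh, hpeq] with ω h1 h2
  rw [mul_assoc, ← h2, h1.2]

end CondRatio

section Measurability

variable {Ω 𝒳 𝒴 : Type*} [m0 : MeasurableSpace Ω] [MeasurableSpace 𝒳] [MeasurableSpace 𝒴]

theorem DataStream.past_le (P : DataStream Ω 𝒳 𝒴) (t : ℤ) : P.past t ≤ m0 :=
  iSup₂_le fun k hk =>
    ((P.measurable_X k hk.1).prodMk (P.measurable_Y k hk.1)).comap_le

theorem DataStream.past_mono (P : DataStream Ω 𝒳 𝒴) : Monotone P.past := fun _ _ hst =>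
  iSup₂_le fun k hk => le_iSup₂_of_le k ⟨hk.1, hk.2.trans hst⟩ le_rfl

theorem DataStream.measurable_pair (P : DataStream Ω 𝒳 𝒴) {k t : ℤ} (h1 : 1 - (P.n : ℤ) ≤ k)
    (h2 : k ≤ t) : Measurable[P.past t] (fun ω => (P.X k ω, P.Y k ω)) := by
  rw [measurable_iff_comap_le]
  exact le_iSup₂_of_le k ⟨h1, h2⟩ le_rfl

variable {P : DataStream Ω 𝒳 𝒴}

theorem measurable_sel_comp (R : Rules P) {t : ℕ} (ht : 1 ≤ t) {q : Ω → ℝ}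
    (hq : Measurable[P.past ((t : ℤ) - 1)] q) :
    Measurable[P.past t] (fun ω => R.sel t ω (P.X t ω) (q ω)) := by
  have hle : P.past ((t : ℤ) - 1) ≤ P.past t := P.past_mono (by omega)
  have hid : Measurable[P.past t, P.past ((t : ℤ) - 1)] (id : Ω → Ω) :=
    measurable_id'' hle
  have hX : Measurable[P.past t] (P.X t) :=
    measurable_fst.comp (P.measurable_pair (by omega) le_rfl)
  have h : @Measurable _ _ (P.past t)
      ((P.past ((t : ℤ) - 1)).prod (inferInstance : MeasurableSpace (𝒳 × ℝ)))
      (fun ω => (id ω, P.X t ω, q ω)) :=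
    @Measurable.prodMk _ _ _ _ (P.past ((t : ℤ) - 1)) _ _ _ hid
      (hX.prodMk (hq.mono hle le_rfl))
  exact (R.measurable_sel t ht).comp h

theorem measurable_err_comp (R : Rules P) {t : ℕ} (ht : 1 ≤ t) {q : Ω → ℝ}
    (hq : Measurable[P.past ((t : ℤ) - 1)] q) :
    Measurable[P.past t]
      (fun ω => R.err t (P.Y t ω) (R.predSet t ω (P.X t ω) (q ω))) := by
  have hle : P.past ((t : ℤ) - 1) ≤ P.past t := P.past_mono (by omega)
  have hid : Measurable[P.past t, P.past ((t : ℤ) - 1)] (id : Ω → Ω) :=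
    measurable_id'' hle
  have hXY := P.measurable_pair (k := t) (t := t) (by omega) le_rfl
  have hX : Measurable[P.past t] (P.X t) := measurable_fst.comp hXY
  have hY : Measurable[P.past t] (P.Y t) := measurable_snd.comp hXY
  have h : @Measurable _ _ (P.past t)
      ((P.past ((t : ℤ) - 1)).prod (inferInstance : MeasurableSpace (𝒳 × ℝ × 𝒴)))
      (fun ω => (id ω, P.X t ω, q ω, P.Y t ω)) :=
    @Measurable.prodMk _ _ _ _ (P.past ((t : ℤ) - 1)) _ _ _ hid
      (hX.prodMk ((hq.mono hle le_rfl).prodMk hY))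
  exact (R.measurable_err t ht).comp h

theorem measurable_state (R : Rules P) (γ : ℕ → ℝ) (α q₁ : ℝ) (t : ℕ) :
    Measurable[P.past t] (state R γ α q₁ t) := by
  induction t with
  | zero => exact measurable_const
  | succ t ih =>
    have hcast : ((t + 1 : ℕ) : ℤ) - 1 = t := by push_cast; ring
    have hle : P.past (t : ℤ) ≤ P.past ((t + 1 : ℕ) : ℤ) := P.past_mono (by push_cast; omega)
    have hq : Measurable[P.past (((t + 1 : ℕ) : ℤ) - 1)] (fun ω => (state R γ α q₁ t ω).1) := by
      rw [hcast]; exact measurable_fst.comp ih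
    have hq' : Measurable[P.past ((t + 1 : ℕ) : ℤ)] (fun ω => (state R γ α q₁ t ω).1) :=
      (measurable_fst.comp ih).mono hle le_rfl
    have hj' : Measurable[P.past ((t + 1 : ℕ) : ℤ)] (fun ω => (state R γ α q₁ t ω).2) :=
      (measurable_snd.comp ih).mono hle le_rfl
    have hs := measurable_sel_comp R (t := t + 1) (by omega) hq
    have he := measurable_err_comp R (t := t + 1) (by omega) hq
    have hγ : Measurable[P.past ((t + 1 : ℕ) : ℤ)] (fun ω => γ (state R γ α q₁ t ω).2) :=
      (measurable_of_countable γ).comp hj'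
    have hr : Measurable[P.past ((t + 1 : ℕ) : ℤ)] (fun ω => react R (t + 1)
        (P.Y ((t + 1 : ℕ) : ℤ) ω) (R.predSet (t + 1) ω (P.X ((t + 1 : ℕ) : ℤ) ω)
          (state R γ α q₁ t ω).1) (state R γ α q₁ t ω).1) := by
      refine Measurable.ite ?_ he measurable_const
      exact hq' measurableSet_Ici
    have hs' : Measurable[P.past ((t + 1 : ℕ) : ℤ)] (fun ω => (R.sel (t + 1) ω
        (P.X ((t + 1 : ℕ) : ℤ) ω) (state R γ α q₁ t ω).1 : ℝ)) :=
      (measurable_of_countable (fun k : ℕ => (k : ℝ))).comp hs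
    exact (hq'.add ((hγ.mul (hr.sub measurable_const)).mul hs')).prodMk (hj'.add hs)

theorem measurable_threshold (R : Rules P) (γ : ℕ → ℝ) (α q₁ : ℝ) {t : ℕ} (ht : 1 ≤ t) :
    Measurable[P.past ((t : ℤ) - 1)] (threshold R γ α q₁ t) := by
  have h := measurable_state R γ α q₁ (t - 1)
  rw [Nat.cast_sub ht, Nat.cast_one] at h
  exact measurable_fst.comp h

theorem measurable_selNumber (R : Rules P) (γ : ℕ → ℝ) (α q₁ : ℝ) {t : ℕ} (ht : 1 ≤ t) :
    Measurable[P.past ((t : ℤ) - 1)] (selNumber R γ α q₁ t) := by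
  have h := measurable_state R γ α q₁ (t - 1)
  rw [Nat.cast_sub ht, Nat.cast_one] at h
  have h2 : selNumber R γ α q₁ t = fun ω => (state R γ α q₁ (t - 1) ω).2 := by
    funext ω
    rw [state_snd, Nat.sub_add_cancel ht]
  rw [h2]
  exact measurable_snd.comp h

end Measurability

section Paths

variable {Ω 𝒳 𝒴 : Type*} [m0 : MeasurableSpace Ω] [MeasurableSpace 𝒳] [MeasurableSpace 𝒴]
  {P : DataStream Ω 𝒳 𝒴} (R : Rules P) (γ : ℕ → ℝ) (α q₁ : ℝ)

/-- The selection indicator `S_t(X_t, q_t)`. -/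
noncomputable def selAt (t : ℕ) (ω : Ω) : ℕ := R.sel t ω (P.X t ω) (threshold R γ α q₁ t ω)

/-- The error `err_t(Y_t, 𝒞_t(X_t, q_t))`. -/
noncomputable def errAt (t : ℕ) (ω : Ω) : ℝ :=
  R.err t (P.Y t ω) (R.predSet t ω (P.X t ω) (threshold R γ α q₁ t ω))

theorem selAt_mem {t : ℕ} (ht : 1 ≤ t) (ω : Ω) :
    selAt R γ α q₁ t ω = 0 ∨ selAt R γ α q₁ t ω = 1 :=
  R.sel_zero_or_one t ht ω _ _

theorem errAt_mem {t : ℕ} (ht : 1 ≤ t) (ω : Ω) : errAt R γ α q₁ t ω ∈ Set.Icc (0 : ℝ) 1 :=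
  R.err_mem t ht _ _

theorem measurable_selAt {t : ℕ} (ht : 1 ≤ t) : Measurable[P.past t] (selAt R γ α q₁ t) :=
  measurable_sel_comp R ht (measurable_threshold R γ α q₁ ht)

theorem measurable_errAt {t : ℕ} (ht : 1 ≤ t) : Measurable[P.past t] (errAt R γ α q₁ t) :=
  measurable_err_comp R ht (measurable_threshold R γ α q₁ ht)

theorem selNumber_succ {t : ℕ} (ht : 1 ≤ t) (ω : Ω) :
    selNumber R γ α q₁ (t + 1) ω = selNumber R γ α q₁ t ω + selAt R γ α q₁ t ω := by
  rw [selNumber, Finset.sum_Ico_succ_top ht, selNumber, selAt]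
  ring

theorem one_le_selNumber (t : ℕ) (ω : Ω) : 1 ≤ selNumber R γ α q₁ t ω := by
  rw [selNumber]; omega

theorem selNumber_mono {s t : ℕ} (hst : s ≤ t) (ω : Ω) :
    selNumber R γ α q₁ s ω ≤ selNumber R γ α q₁ t ω := by
  unfold selNumber
  gcongr

theorem sum_selAt {s t : ℕ} (hs : 1 ≤ s) (hst : s ≤ t) (ω : Ω) :
    ∑ i ∈ Finset.Ico s t, (selAt R γ α q₁ i ω : ℝ)
      = selNumber R γ α q₁ t ω - selNumber R γ α q₁ s ω := by
  induction t, hst using Nat.le_induction with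
  | base => simp
  | succ t hst ih =>
    rw [Finset.sum_Ico_succ_top hst, ih, selNumber_succ R γ α q₁ (hs.trans hst)]
    push_cast
    ring

theorem selNumber_le {t : ℕ} (ht : 1 ≤ t) (ω : Ω) : selNumber R γ α q₁ t ω ≤ t := by
  induction t, ht using Nat.le_induction with
  | base => simp [selNumber]
  | succ t ht ih =>
    rw [selNumber_succ R γ α q₁ ht]
    rcases selAt_mem R γ α q₁ ht ω with h | h <;> omega

theorem threshold_succ_of_nonneg {t : ℕ} (ht : 1 ≤ t) {ω : Ω} (h : 0 ≤ threshold R γ α q₁ t ω) :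
    threshold R γ α q₁ (t + 1) ω = threshold R γ α q₁ t ω + γ (selNumber R γ α q₁ t ω)
      * (errAt R γ α q₁ t ω - α) * selAt R γ α q₁ t ω := by
  rw [threshold_succ R γ α q₁ t ht, react, if_pos h]
  rfl

theorem threshold_succ_of_neg {t : ℕ} (ht : 1 ≤ t) {ω : Ω} (h : threshold R γ α q₁ t ω < 0) :
    threshold R γ α q₁ (t + 1) ω = threshold R γ α q₁ t ω + γ (selNumber R γ α q₁ t ω)
      * (1 - α) * selAt R γ α q₁ t ω := by
  rw [threshold_succ R γ α q₁ t ht, react, if_neg (not_le.mpr h)]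
  rfl

theorem threshold_succ_of_ge {t : ℕ} (ht : 1 ≤ t) {ω : Ω} (h : R.B ≤ threshold R γ α q₁ t ω) :
    threshold R γ α q₁ (t + 1) ω = threshold R γ α q₁ t ω + γ (selNumber R γ α q₁ t ω)
      * (-α) * selAt R γ α q₁ t ω := by
  rw [threshold_succ_of_nonneg R γ α q₁ ht (R.B_pos.le.trans h)]
  rcases R.above_B t ht ω (P.X t ω) _ h with h1 | h1
  · rw [errAt, h1, R.err_univ t ht, zero_sub]
  · rw [selAt, h1]; simp

theorem abs_threshold_succ_sub_le {t : ℕ} (ht : 1 ≤ t) (ω : Ω) (hα : α ∈ Set.Ioo (0 : ℝ) 1)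
    {b : ℝ} (h0 : 0 ≤ γ (selNumber R γ α q₁ t ω)) (hb : γ (selNumber R γ α q₁ t ω) ≤ b) :
    |threshold R γ α q₁ (t + 1) ω - threshold R γ α q₁ t ω| ≤ b := by
  obtain ⟨hα0, hα1⟩ := hα
  have key : ∀ e : ℝ, |e| ≤ 1 →
      |γ (selNumber R γ α q₁ t ω) * e * selAt R γ α q₁ t ω| ≤ b := by
    intro e he
    rw [abs_mul, abs_mul, abs_of_nonneg h0]
    have hs : |(selAt R γ α q₁ t ω : ℝ)| ≤ 1 := by
      rcases selAt_mem R γ α q₁ ht ω with h | h <;> rw [h] <;> simp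
    calc _ ≤ γ (selNumber R γ α q₁ t ω) * 1 * 1 := by gcongr
      _ ≤ b := by simpa using hb
  obtain ⟨he0, he1⟩ := errAt_mem R γ α q₁ ht ω
  rcases lt_or_ge (threshold R γ α q₁ t ω) 0 with h | h
  · rw [threshold_succ_of_neg R γ α q₁ ht h, add_sub_cancel_left]
    exact key _ (abs_le.mpr ⟨by linarith, by linarith⟩)
  · rw [threshold_succ_of_nonneg R γ α q₁ ht h, add_sub_cancel_left]
    exact key _ (abs_le.mpr ⟨by linarith, by linarith⟩)

theorem threshold_mem (hα : α ∈ Set.Ioo (0 : ℝ) 1) (hq₁ : q₁ ∈ Set.Icc 0 R.B) {b : ℝ}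
    (h0 : ∀ j, 0 ≤ γ j) (hb : ∀ j, 1 ≤ j → γ j ≤ b) {t : ℕ} (ht : 1 ≤ t) (ω : Ω) :
    threshold R γ α q₁ t ω ∈ Set.Icc (-b) (R.B + b) := by
  have hb0 : 0 ≤ b := (h0 1).trans (hb 1 le_rfl)
  induction t, ht using Nat.le_induction with
  | base => rw [threshold_one]; exact ⟨by linarith [hq₁.1], by linarith [hq₁.2]⟩
  | succ t ht ih =>
    have hstep := abs_le.mp (abs_threshold_succ_sub_le R γ α q₁ ht ω hα (h0 _)
      (hb _ (one_le_selNumber R γ α q₁ t ω)))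
    obtain ⟨hα0, hα1⟩ := hα
    have hs0 : (0 : ℝ) ≤ selAt R γ α q₁ t ω := Nat.cast_nonneg _
    have hg := h0 (selNumber R γ α q₁ t ω)
    have hB := R.B_pos
    rcases lt_or_ge (threshold R γ α q₁ t ω) 0 with h | h
    · have h1 := threshold_succ_of_neg R γ α q₁ ht h
      have h2 : 0 ≤ γ (selNumber R γ α q₁ t ω) * (1 - α) * selAt R γ α q₁ t ω :=
        mul_nonneg (mul_nonneg hg (by linarith)) hs0
      exact ⟨by linarith [ih.1], by linarith⟩
    · rcases lt_or_ge (threshold R γ α q₁ t ω) R.B with h' | h'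
      · exact ⟨by linarith, by linarith⟩
      · have h1 := threshold_succ_of_ge R γ α q₁ ht h'
        have h2 : 0 ≤ γ (selNumber R γ α q₁ t ω) * α * selAt R γ α q₁ t ω :=
          mul_nonneg (mul_nonneg hg hα0.le) hs0
        exact ⟨by linarith, by linarith [ih.2]⟩

end Paths

section Noise

variable {Ω 𝒳 𝒴 : Type*} [m0 : MeasurableSpace Ω] [MeasurableSpace 𝒳] [MeasurableSpace 𝒴]
  (μ : Measure Ω)
  {P : DataStream Ω 𝒳 𝒴} (R : Rules P) (γ : ℕ → ℝ) (α q₁ : ℝ)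

/-- The instantaneous error rate, truncated to `[0, 1]`. -/
noncomputable def ierTrunc (t : ℕ) (ω : Ω) : ℝ := max 0 (min 1 (ier μ R γ α q₁ t ω))

open Classical in
/-- The step size at time `t`, set to `0` unless `q_t ∈ [0, B]`. -/
noncomputable def stepInside (t : ℕ) (ω : Ω) : ℝ :=
  if threshold R γ α q₁ t ω ∈ Set.Icc 0 R.B then γ (selNumber R γ α q₁ t ω) else 0

/-- The centered error at a selected time. -/
noncomputable def noise (t : ℕ) (ω : Ω) : ℝ :=
  (errAt R γ α q₁ t ω - ierTrunc μ R γ α q₁ t ω) * selAt R γ α q₁ t ω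

theorem ierTrunc_mem (t : ℕ) (ω : Ω) : ierTrunc μ R γ α q₁ t ω ∈ Set.Icc (0 : ℝ) 1 :=
  ⟨le_max_left _ _, max_le zero_le_one (min_le_left _ _)⟩

theorem measurable_ierTrunc (t : ℕ) :
    Measurable[P.past ((t : ℤ) - 1)] (ierTrunc μ R γ α q₁ t) := by
  refine measurable_const.max (measurable_const.min ?_)
  exact stronglyMeasurable_condExp.measurable.div stronglyMeasurable_condExp.measurable

variable [IsProbabilityMeasure μ]

theorem integrable_selAt {t : ℕ} (ht : 1 ≤ t) :
    Integrable (fun ω => (selAt R γ α q₁ t ω : ℝ)) μ := by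
  refine integrable_of_abs_le (K := 1) ((measurable_of_countable (fun k : ℕ => (k : ℝ))).comp
    ((measurable_selAt R γ α q₁ ht).mono (P.past_le _) le_rfl)) fun ω => ?_
  rcases selAt_mem R γ α q₁ ht ω with h | h <;> rw [h] <;> simp

theorem integrable_errAt_mul_selAt {t : ℕ} (ht : 1 ≤ t) :
    Integrable (fun ω => errAt R γ α q₁ t ω * (selAt R γ α q₁ t ω : ℝ)) μ := by
  refine integrable_of_abs_le (K := 1)
    (((measurable_errAt R γ α q₁ ht).mono (P.past_le _) le_rfl).mul
      ((measurable_of_countable (fun k : ℕ => (k : ℝ))).comp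
        ((measurable_selAt R γ α q₁ ht).mono (P.past_le _) le_rfl))) fun ω => ?_
  obtain ⟨h0, h1⟩ := errAt_mem R γ α q₁ ht ω
  rcases selAt_mem R γ α q₁ ht ω with h | h <;> rw [h]
  · simp
  · simpa [abs_of_nonneg h0] using h1

theorem ier_mem {t : ℕ} (ht : 1 ≤ t) :
    ∀ᵐ ω ∂μ, ier μ R γ α q₁ t ω ∈ Set.Icc (0 : ℝ) 1 := by
  have := condExp_ratio_mem (m := P.past ((t : ℤ) - 1))
    (integrable_errAt_mul_selAt μ R γ α q₁ ht) (integrable_selAt μ R γ α q₁ ht)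
    (fun ω => mul_nonneg (errAt_mem R γ α q₁ ht ω).1 (Nat.cast_nonneg _))
    (fun ω => mul_le_of_le_one_left (Nat.cast_nonneg _) (errAt_mem R γ α q₁ ht ω).2)
  filter_upwards [this] with ω h
  exact h.1

theorem ier_eq_ierTrunc {t : ℕ} (ht : 1 ≤ t) :
    ∀ᵐ ω ∂μ, ier μ R γ α q₁ t ω = ierTrunc μ R γ α q₁ t ω := by
  filter_upwards [ier_mem μ R γ α q₁ ht] with ω h
  rw [ierTrunc, min_eq_right h.2, max_eq_right h.1]

theorem isSelectedNoise {K : ℝ} (h0 : ∀ j, 0 ≤ γ j) (hK : ∀ j, 1 ≤ j → γ j ≤ K) {a : ℕ}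
    (ha : 1 ≤ a) :
    IsSelectedNoise μ (fun t => P.past ((t : ℤ) - 1)) (stepInside R γ α q₁)
      (noise μ R γ α q₁) (fun t ω => (selAt R γ α q₁ t ω : ℝ)) a K := by
  have hcast : ∀ t : ℕ, ((t + 1 : ℕ) : ℤ) - 1 = t := fun t => by push_cast; ring
  have hs : ∀ t : ℕ, 1 ≤ t → Measurable[P.past t] (fun ω => (selAt R γ α q₁ t ω : ℝ)) := fun t ht =>
    (measurable_of_countable (fun k : ℕ => (k : ℝ))).comp (measurable_selAt R γ α q₁ ht)
  refine ⟨fun t => P.past_le _, fun s t hst => P.past_mono (by omega), fun t ht => ?_,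
    fun t ht => ?_, fun t ht => ?_, fun t ht ω => ?_, fun t ht ω => ?_, fun t ht ω => ?_,
    fun t ht W hW hC => ?_⟩
  · have ht := ha.trans ht
    exact Measurable.ite ((measurable_threshold R γ α q₁ ht) measurableSet_Icc)
      ((measurable_of_countable γ).comp (measurable_selNumber R γ α q₁ ht)) measurable_const
  · have ht := ha.trans ht
    rw [hcast]
    exact ((measurable_errAt R γ α q₁ ht).sub ((measurable_ierTrunc μ R γ α q₁ t).mono
      (P.past_mono (by omega)) le_rfl)).mul (hs t ht)
  · rw [hcast]
    exact hs t (ha.trans ht)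
  · have hj := one_le_selNumber R γ α q₁ t ω
    unfold stepInside
    split_ifs
    · rw [abs_of_nonneg (h0 _)]; exact hK _ hj
    · rw [abs_zero]; exact (h0 _).trans (hK _ hj)
  · exact_mod_cast selAt_mem R γ α q₁ (ha.trans ht) ω
  · rw [noise, abs_mul, Nat.abs_cast]
    refine mul_le_of_le_one_left (Nat.cast_nonneg _) ?_
    have h1 := errAt_mem R γ α q₁ (ha.trans ht) ω
    have h2 := ierTrunc_mem μ R γ α q₁ t ω
    exact abs_le.mpr ⟨by linarith [h1.1, h2.2], by linarith [h1.2, h2.1]⟩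
  · have ht := ha.trans ht
    obtain ⟨C, hC⟩ := hC
    have := integral_mul_sub_condExp_ratio (μ := μ) (P.past_le ((t : ℤ) - 1))
      (integrable_errAt_mul_selAt μ R γ α q₁ ht) (integrable_selAt μ R γ α q₁ ht)
      (fun ω => mul_nonneg (errAt_mem R γ α q₁ ht ω).1 (Nat.cast_nonneg _))
      (fun ω => mul_le_of_le_one_left (Nat.cast_nonneg _) (errAt_mem R γ α q₁ ht ω).2)
      (measurable_ierTrunc μ R γ α q₁ t) (ierTrunc_mem μ R γ α q₁ t)
      (ier_eq_ierTrunc μ R γ α q₁ ht) hW hC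
    rw [← this]
    refine integral_congr_ae (ae_of_all _ fun ω => ?_)
    simp only [noise]
    ring

end Noise

end OnlineSCI

namespace OnlineSCI

/-- The quantitative form in which the regularity of the benchmark function is used: it decreases
through `α` at a linear rate near `q₀`, and it is globally Lipschitz at `q₀`. -/
structure BenchmarkBounds (B α q₀ : ℝ) (Pi0 : ℝ → ℝ) (δ κ L : ℝ) : Prop where
  δ_pos : 0 < δ
  κ_pos : 0 < κ
  L_pos : 0 < L
  below : δ ≤ q₀
  above : q₀ + δ ≤ B
  le_sub : ∀ ε, 0 ≤ ε → ε ≤ δ → Pi0 (q₀ + ε) ≤ α - κ * ε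
  add_le : ∀ ε, 0 ≤ ε → ε ≤ δ → α + κ * ε ≤ Pi0 (q₀ - ε)
  lipschitz : ∀ q ∈ Set.Icc 0 B, |Pi0 q - α| ≤ L * |q - q₀|
  outside : ∀ q, q ∉ Set.Icc 0 B → 1 ≤ L * |q - q₀|

theorem IsBenchmark.exists_bounds {B α q₀ : ℝ} {Pi0 : ℝ → ℝ} (h : IsBenchmark B α q₀ Pi0) :
    ∃ δ κ L, BenchmarkBounds B α q₀ Pi0 δ κ L := by
  obtain ⟨h0, hB⟩ := h.q₀_mem
  set d := deriv Pi0 q₀ with hd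
  have hd0 : d < 0 := h.deriv_neg
  have hderiv : HasDerivAt Pi0 d q₀ := (differentiableAt_of_deriv_ne_zero hd0.ne).hasDerivAt
  have hlittle := hderiv.isLittleO.def (c := -d / 2) (by linarith)
  obtain ⟨δ₀, hδ₀, hball⟩ := Metric.eventually_nhds_iff.mp hlittle
  set δ := min (δ₀ / 2) (min q₀ (B - q₀)) with hδ
  have hδpos : 0 < δ := lt_min (by linarith) (lt_min h0 (by linarith))
  have hδ1 : δ < δ₀ := (min_le_left _ _).trans_lt (by linarith)
  have hδ2 : δ ≤ q₀ := (min_le_right _ _).trans (min_le_left _ _)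
  have hδ3 : δ ≤ B - q₀ := (min_le_right _ _).trans (min_le_right _ _)
  have hloc : ∀ q, |q - q₀| ≤ δ → |Pi0 q - α - (q - q₀) * d| ≤ -d / 2 * |q - q₀| := by
    intro q hq
    have := hball (y := q) (by rw [Real.dist_eq]; linarith)
    simpa [h.value, Real.norm_eq_abs] using this
  have hα : α ∈ Set.Icc (0 : ℝ) 1 := h.value ▸ h.mem_unit q₀ ⟨h0.le, hB.le⟩
  have hfar : ∀ q, δ < |q - q₀| → 1 ≤ (-(3 / 2) * d + δ⁻¹) * |q - q₀| := by
    intro q hq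
    have h1 : δ⁻¹ * δ ≤ δ⁻¹ * |q - q₀| := by gcongr
    rw [inv_mul_cancel₀ hδpos.ne'] at h1
    have h2 : 0 ≤ -(3 / 2) * d * |q - q₀| := mul_nonneg (by linarith) (abs_nonneg _)
    linarith
  refine ⟨δ, -d / 2, -(3 / 2) * d + δ⁻¹, hδpos, by linarith, ?_, hδ2, by linarith, ?_, ?_, ?_, ?_⟩
  · have := inv_pos.mpr hδpos
    linarith
  · intro ε hε hεδ
    have := hloc (q₀ + ε) (by rwa [add_sub_cancel_left, abs_of_nonneg hε])
    rw [add_sub_cancel_left, abs_of_nonneg hε] at this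
    linarith [(abs_le.mp this).2]
  · intro ε hε hεδ
    have e : q₀ - ε - q₀ = -ε := by ring
    have := hloc (q₀ - ε) (by rwa [e, abs_neg, abs_of_nonneg hε])
    rw [e, abs_neg, abs_of_nonneg hε] at this
    linarith [(abs_le.mp this).1]
  · intro q hq
    rcases le_or_gt |q - q₀| δ with hqδ | hqδ
    · have h1 := hloc q hqδ
      have h2 : |Pi0 q - α| ≤ |Pi0 q - α - (q - q₀) * d| + |(q - q₀) * d| := by
        have := abs_add_le (Pi0 q - α - (q - q₀) * d) ((q - q₀) * d)
        rwa [sub_add_cancel] at this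
      rw [abs_mul, abs_of_neg hd0] at h2
      have h3 : 0 ≤ δ⁻¹ * |q - q₀| := by positivity
      linarith
    · refine le_trans ?_ (hfar q hqδ)
      have := h.mem_unit q hq
      exact abs_le.mpr ⟨by linarith [this.1, hα.2], by linarith [this.2, hα.1]⟩
  · intro q hq
    refine hfar q ?_
    rw [Set.mem_Icc, not_and_or, not_le, not_le] at hq
    rcases hq with hq | hq
    · rw [abs_of_neg (by linarith)]; linarith
    · rw [abs_of_pos (by linarith)]; linarith

section Path

variable {Ω 𝒳 𝒴 : Type*} [m0 : MeasurableSpace Ω] [MeasurableSpace 𝒳] [MeasurableSpace 𝒴]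
  {μ : Measure Ω} {P : DataStream Ω 𝒳 𝒴} {R : Rules P} {γ : ℕ → ℝ} {α q₁ q₀ : ℝ}
  {Pi0 : ℝ → ℝ} {δ κ L : ℝ}

theorem abs_ier_sub_benchmark_le {t : ℕ} {ω : Ω} {D : ℝ}
    (hin : threshold R γ α q₁ t ω ∈ Set.Icc 0 R.B)
    (hD : benchDist μ R γ α q₁ Pi0 t ω ≤ D) :
    |ier μ R γ α q₁ t ω - Pi0 (threshold R γ α q₁ t ω)| ≤ D := by
  rwa [benchDist, if_pos hin] at hD

theorem threshold_succ_of_mem {t : ℕ} (ht : 1 ≤ t) {ω : Ω}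
    (hin : threshold R γ α q₁ t ω ∈ Set.Icc 0 R.B)
    (hier : ier μ R γ α q₁ t ω = ierTrunc μ R γ α q₁ t ω) :
    threshold R γ α q₁ (t + 1) ω = threshold R γ α q₁ t ω
      + stepInside R γ α q₁ t ω * noise μ R γ α q₁ t ω
      + (ier μ R γ α q₁ t ω - α) * (γ (selNumber R γ α q₁ t ω) * selAt R γ α q₁ t ω) := by
  rw [threshold_succ_of_nonneg R γ α q₁ ht hin.1, stepInside, if_pos hin, noise, hier]
  ring

theorem stepInside_of_not_mem {t : ℕ} {ω : Ω} (h : threshold R γ α q₁ t ω ∉ Set.Icc 0 R.B) :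
    stepInside R γ α q₁ t ω = 0 := by
  rw [stepInside, if_neg h]

/-- Above `q₀ + ε` the threshold drifts downwards. -/
theorem drift_above (hb : BenchmarkBounds R.B α q₀ Pi0 δ κ L)
    (hanti : AntitoneOn Pi0 (Set.Icc 0 R.B)) {t : ℕ} (ht : 1 ≤ t) {ω : Ω} {D ε : ℝ}
    (h0 : ∀ j, 0 ≤ γ j) (hε0 : 0 ≤ ε) (hεδ : ε ≤ δ) (hDε : 2 * D ≤ κ * ε) (hεα : κ * ε ≤ 2 * α)
    (hier : ier μ R γ α q₁ t ω = ierTrunc μ R γ α q₁ t ω)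
    (hD : benchDist μ R γ α q₁ Pi0 t ω ≤ D) (hlt : ε < threshold R γ α q₁ t ω - q₀) :
    threshold R γ α q₁ (t + 1) ω ≤ threshold R γ α q₁ t ω
      + stepInside R γ α q₁ t ω * noise μ R γ α q₁ t ω
      - κ * ε / 2 * (γ (selNumber R γ α q₁ t ω) * selAt R γ α q₁ t ω) := by
  have hw : 0 ≤ γ (selNumber R γ α q₁ t ω) * selAt R γ α q₁ t ω :=
    mul_nonneg (h0 _) (Nat.cast_nonneg _)
  have hδ := hb.δ_pos
  have hq₀ := hb.below
  have hB := hb.above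
  rcases le_or_gt (threshold R γ α q₁ t ω) R.B with hle | hgt
  · have hin : threshold R γ α q₁ t ω ∈ Set.Icc 0 R.B := ⟨by linarith, hle⟩
    have h1 := (abs_le.mp (abs_ier_sub_benchmark_le hin hD)).2
    have h2 : Pi0 (threshold R γ α q₁ t ω) ≤ Pi0 (q₀ + ε) :=
      hanti ⟨by linarith, by linarith⟩ hin (by linarith)
    have h3 := hb.le_sub ε hε0 hεδ
    rw [threshold_succ_of_mem ht hin hier]
    have h4 : (ier μ R γ α q₁ t ω - α) * (γ (selNumber R γ α q₁ t ω) * selAt R γ α q₁ t ω)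
        ≤ (-(κ * ε / 2)) * (γ (selNumber R γ α q₁ t ω) * selAt R γ α q₁ t ω) :=
      mul_le_mul_of_nonneg_right (by linarith) hw
    linarith
  · rw [threshold_succ_of_ge R γ α q₁ ht hgt.le, stepInside_of_not_mem fun h => hgt.not_ge h.2]
    have h4 : κ * ε / 2 * (γ (selNumber R γ α q₁ t ω) * selAt R γ α q₁ t ω)
        ≤ α * (γ (selNumber R γ α q₁ t ω) * selAt R γ α q₁ t ω) :=
      mul_le_mul_of_nonneg_right (by linarith) hw
    linarith

/-- Below `q₀ - ε` the threshold drifts upwards. -/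
theorem drift_below (hb : BenchmarkBounds R.B α q₀ Pi0 δ κ L)
    (hanti : AntitoneOn Pi0 (Set.Icc 0 R.B)) {t : ℕ} (ht : 1 ≤ t) {ω : Ω} {D ε : ℝ}
    (h0 : ∀ j, 0 ≤ γ j) (hε0 : 0 ≤ ε) (hεδ : ε ≤ δ) (hDε : 2 * D ≤ κ * ε)
    (hεα : κ * ε ≤ 2 * (1 - α))
    (hier : ier μ R γ α q₁ t ω = ierTrunc μ R γ α q₁ t ω)
    (hD : benchDist μ R γ α q₁ Pi0 t ω ≤ D) (hlt : ε < q₀ - threshold R γ α q₁ t ω) :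
    threshold R γ α q₁ t ω + stepInside R γ α q₁ t ω * noise μ R γ α q₁ t ω
      + κ * ε / 2 * (γ (selNumber R γ α q₁ t ω) * selAt R γ α q₁ t ω)
      ≤ threshold R γ α q₁ (t + 1) ω := by
  have hw : 0 ≤ γ (selNumber R γ α q₁ t ω) * selAt R γ α q₁ t ω :=
    mul_nonneg (h0 _) (Nat.cast_nonneg _)
  have hδ := hb.δ_pos
  have hq₀ := hb.below
  have hB := hb.above
  rcases le_or_gt 0 (threshold R γ α q₁ t ω) with hle | hgt
  · have hin : threshold R γ α q₁ t ω ∈ Set.Icc 0 R.B := ⟨hle, by linarith⟩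
    have h1 := (abs_le.mp (abs_ier_sub_benchmark_le hin hD)).1
    have h2 : Pi0 (q₀ - ε) ≤ Pi0 (threshold R γ α q₁ t ω) :=
      hanti hin ⟨by linarith, by linarith⟩ (by linarith)
    have h3 := hb.add_le ε hε0 hεδ
    rw [threshold_succ_of_mem ht hin hier]
    have h4 : κ * ε / 2 * (γ (selNumber R γ α q₁ t ω) * selAt R γ α q₁ t ω)
        ≤ (ier μ R γ α q₁ t ω - α) * (γ (selNumber R γ α q₁ t ω) * selAt R γ α q₁ t ω) :=
      mul_le_mul_of_nonneg_right (by linarith) hw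
    linarith
  · rw [threshold_succ_of_neg R γ α q₁ ht hgt, stepInside_of_not_mem fun h => hgt.not_ge h.1]
    have h4 : κ * ε / 2 * (γ (selNumber R γ α q₁ t ω) * selAt R γ α q₁ t ω)
        ≤ (1 - α) * (γ (selNumber R γ α q₁ t ω) * selAt R γ α q₁ t ω) :=
      mul_le_mul_of_nonneg_right (by linarith) hw
    linarith

/-- On a path along which the benchmark distance and the noise are controlled, the threshold ends
close to `q₀`. -/
theorem abs_threshold_sub_le (hb : BenchmarkBounds R.B α q₀ Pi0 δ κ L)
    (hanti : AntitoneOn Pi0 (Set.Icc 0 R.B)) (hα : α ∈ Set.Ioo (0 : ℝ) 1) {t₀ T : ℕ}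
    (ht₀ : 1 ≤ t₀) (hT : t₀ ≤ T) {ω : Ω} {D ε b a M : ℝ}
    (h0 : ∀ j, 0 ≤ γ j) (hε0 : 0 ≤ ε) (hεδ : ε ≤ δ) (hDε : 2 * D ≤ κ * ε)
    (hεα : κ * ε ≤ 2 * α) (hεα' : κ * ε ≤ 2 * (1 - α)) (hb0 : 0 ≤ b) (ha0 : 0 ≤ a)
    (hier : ∀ t, t₀ ≤ t → t ≤ T → ier μ R γ α q₁ t ω = ierTrunc μ R γ α q₁ t ω)
    (hD : ∀ t, t₀ ≤ t → t ≤ T → benchDist μ R γ α q₁ Pi0 t ω ≤ D)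
    (hstep : ∀ t, t₀ ≤ t → t < T → γ (selNumber R γ α q₁ t ω) ≤ b)
    (hnoise : ∀ s, t₀ ≤ s → s ≤ T →
      |∑ t ∈ Finset.Ico s T, stepInside R γ α q₁ t ω * noise μ R γ α q₁ t ω| ≤ a)
    (hM : |threshold R γ α q₁ t₀ ω - q₀| ≤ M)
    (hpush : M ≤ κ * ε / 2 * ∑ t ∈ Finset.Ico t₀ T,
      γ (selNumber R γ α q₁ t ω) * selAt R γ α q₁ t ω) :
    |threshold R γ α q₁ T ω - q₀| ≤ ε + b + a := by
  have hw : ∀ t, 0 ≤ γ (selNumber R γ α q₁ t ω) * selAt R γ α q₁ t ω :=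
    fun t => mul_nonneg (h0 _) (Nat.cast_nonneg _)
  have hθ : 0 ≤ κ * ε / 2 := by have := hb.κ_pos; positivity
  have hM' := abs_le.mp hM
  have hincr : ∀ t, t₀ ≤ t → t < T → |threshold R γ α q₁ (t + 1) ω - threshold R γ α q₁ t ω| ≤ b :=
    fun t h1 h2 => abs_threshold_succ_sub_le R γ α q₁ (ht₀.trans h1) ω hα (h0 _) (hstep t h1 h2)
  rw [abs_le]
  constructor
  · have := le_of_drift (x := fun t => q₀ - threshold R γ α q₁ t ω)
      (ξ := fun t => -(stepInside R γ α q₁ t ω * noise μ R γ α q₁ t ω))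
      hT hε0 hb0 ha0 hw hθ
      (fun t h1 h2 => by linarith [(abs_le.mp (hincr t h1 h2)).1])
      (fun t h1 h2 h3 => by
        have := drift_below hb hanti (ht₀.trans h1) h0 hε0 hεδ hDε hεα' (hier t h1 h2.le)
          (hD t h1 h2.le) h3
        linarith)
      (fun s h1 h2 => by
        rw [Finset.sum_neg_distrib]
        linarith [(abs_le.mp (hnoise s h1 h2)).1])
      (by linarith) hpush
    linarith
  · exact le_of_drift (x := fun t => threshold R γ α q₁ t ω - q₀)
      (ξ := fun t => stepInside R γ α q₁ t ω * noise μ R γ α q₁ t ω)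
      hT hε0 hb0 ha0 hw hθ
      (fun t h1 h2 => by linarith [(abs_le.mp (hincr t h1 h2)).2])
      (fun t h1 h2 h3 => by
        have := drift_above hb hanti (ht₀.trans h1) h0 hε0 hεδ hDε hεα (hier t h1 h2.le)
          (hD t h1 h2.le) h3
        linarith)
      (fun s h1 h2 => (abs_le.mp (hnoise s h1 h2)).2)
      (by linarith) hpush

/-- A bound on the distance of the threshold to `q₀` bounds the error rate. -/
theorem abs_ier_sub_le (hb : BenchmarkBounds R.B α q₀ Pi0 δ κ L) (hα : α ∈ Set.Ioo (0 : ℝ) 1)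
    {t : ℕ} {ω : Ω} {D : ℝ} (hD0 : 0 ≤ D)
    (hier : ier μ R γ α q₁ t ω ∈ Set.Icc (0 : ℝ) 1)
    (hD : benchDist μ R γ α q₁ Pi0 t ω ≤ D) :
    |ier μ R γ α q₁ t ω - α| ≤ D + L * |threshold R γ α q₁ t ω - q₀| := by
  by_cases hin : threshold R γ α q₁ t ω ∈ Set.Icc 0 R.B
  · have h1 := abs_ier_sub_benchmark_le hin hD
    have h2 := hb.lipschitz _ hin
    have h3 := abs_sub_le (ier μ R γ α q₁ t ω) (Pi0 (threshold R γ α q₁ t ω)) α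
    linarith
  · have h1 := hb.outside _ hin
    have h2 : |ier μ R γ α q₁ t ω - α| ≤ 1 :=
      abs_le.mpr ⟨by linarith [hier.1, hα.2], by linarith [hier.2, hα.1]⟩
    linarith

end Path

theorem step_nonneg {c β : ℝ} (hc : 0 < c) (j : ℕ) : 0 ≤ step c β j := by
  unfold step; positivity

theorem step_le {c β : ℝ} (hc : 0 < c) (hβ : 0 < β) {j : ℕ} {A : ℝ} (hA : 0 < A) (hj : A ≤ j) :
    step c β j ≤ c * A ^ (-β) := by
  unfold step
  gcongr c * ?_
  exact Real.rpow_le_rpow_of_nonpos hA hj (by linarith)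

theorem le_step {c β : ℝ} (hc : 0 < c) (hβ : 0 < β) {j : ℕ} {U : ℝ} (h1 : 1 ≤ j) (hj : j ≤ U) :
    c * U ^ (-β) ≤ step c β j := by
  unfold step
  gcongr c * ?_
  exact Real.rpow_le_rpow_of_nonpos (by exact_mod_cast h1) hj (by linarith)

theorem step_le_const {c β : ℝ} (hc : 0 < c) (hβ : 0 < β) {j : ℕ} (h1 : 1 ≤ j) :
    step c β j ≤ c := by
  have := step_le (c := c) hc hβ one_pos (j := j) (by exact_mod_cast h1)
  simpa using this

section Core

variable {Ω 𝒳 𝒴 : Type*} [m0 : MeasurableSpace Ω] [MeasurableSpace 𝒳] [MeasurableSpace 𝒴]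
  {μ : Measure Ω} [IsProbabilityMeasure μ] {P : DataStream Ω 𝒳 𝒴} {R : Rules P}
  {α q₁ q₀ c β : ℝ} {Pi0 : ℝ → ℝ} {δ κ L : ℝ}

theorem bracketFailure_eq (γ : ℕ → ℝ) (Jlow Jup : ℕ → ℤ) {t : ℕ} (ht : 1 ≤ t) :
    μ.real {ω | Jlow t ≤ (selNumber R γ α q₁ t ω : ℤ) ∧ (selNumber R γ α q₁ t ω : ℤ) ≤ Jup t}ᶜ
      = bracketFailure μ R γ α q₁ Jlow Jup t := by
  have hJ : Measurable (selNumber R γ α q₁ t) :=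
    (measurable_selNumber R γ α q₁ ht).mono (P.past_le _) le_rfl
  have hm : MeasurableSet {ω | Jlow t ≤ (selNumber R γ α q₁ t ω : ℤ) ∧
      (selNumber R γ α q₁ t ω : ℤ) ≤ Jup t} :=
    hJ (MeasurableSet.of_discrete (s := {k : ℕ | Jlow t ≤ (k : ℤ) ∧ (k : ℤ) ≤ Jup t}))
  rw [probReal_compl_eq_one_sub hm, bracketFailure]

/-- The non-asymptotic bound: `A, U` bracket the selection numbers in the window `[t₀, T]`, and
`G, N` bracket the number of selections in it. -/
theorem measure_window_ge (hb : BenchmarkBounds R.B α q₀ Pi0 δ κ L)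
    (hanti : AntitoneOn Pi0 (Set.Icc 0 R.B)) (hα : α ∈ Set.Ioo (0 : ℝ) 1) (hc : 0 < c)
    (hβ : 0 < β) (hq₁ : q₁ ∈ Set.Icc 0 R.B) {Jlow Jup : ℕ → ℤ} {t₀ T : ℕ} (ht₀ : 1 ≤ t₀)
    (hT : t₀ ≤ T) {Dbar : ℕ → ℝ} {C₁ D A U G N ε : ℝ} (hD0 : 0 ≤ D)
    (hDbar : ∀ t, t₀ ≤ t → t ≤ T → C₁ * Dbar t ≤ D)
    (hA : 0 < A) (hAJ : A ≤ Jlow t₀) (hU : 0 < U) (hUJ : Jup (T + 1) ≤ U)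
    (hG : 0 < G) (hGJ : G ≤ Jlow (T + 1) - 1 - Jup t₀) (hN : 0 < N)
    (hNJ : Jup (T + 1) - Jlow t₀ ≤ N)
    (hε : ε = 2 / κ * (D + (R.B + c) / (G * (c * U ^ (-β)))))
    (hεδ : ε ≤ δ) (hεα : κ * ε ≤ 2 * α) (hεα' : κ * ε ≤ 2 * (1 - α)) :
    1 - ∑ t ∈ Finset.Icc t₀ T, μ.real {ω | C₁ * Dbar t < benchDist μ R (step c β) α q₁ Pi0 t ω}
        - 2 * (1 / T) - bracketFailure μ R (step c β) α q₁ Jlow Jup t₀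
        - bracketFailure μ R (step c β) α q₁ Jlow Jup (T + 1)
      ≤ μ.real {ω | |ier μ R (step c β) α q₁ T ω - α| + |threshold R (step c β) α q₁ T ω - q₀|
          ≤ D + (L + 1) * (ε + c * A ^ (-β)
            + 2 * Real.sqrt (2 * Real.log T * ((c * A ^ (-β)) ^ 2 * N)))} := by
  set γ := step c β with hγ
  set b := c * A ^ (-β) with hbdef
  set a := 2 * Real.sqrt (2 * Real.log T * (b ^ 2 * N)) with hadef
  set Γ := G * (c * U ^ (-β)) with hΓ
  have hb0 : 0 < b := by positivity
  have hΓ0 : 0 < Γ := by positivity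
  have hκ := hb.κ_pos
  have hBc : 0 ≤ (R.B + c) / Γ := by have := R.B_pos; positivity
  have hε0 : 0 ≤ ε := by rw [hε]; positivity
  have hκε : κ * ε = 2 * D + 2 * ((R.B + c) / Γ) := by rw [hε]; field_simp
  have hT1 : (1 : ℝ) ≤ T := by exact_mod_cast ht₀.trans hT
  have hlog : 0 ≤ 2 * Real.log T := by have := Real.log_nonneg hT1; positivity
  have hγ0 : ∀ j, 0 ≤ γ j := step_nonneg hc
  have hγc : ∀ j, 1 ≤ j → γ j ≤ c := fun j hj => step_le_const hc hβ hj
  set good := {ω | |ier μ R γ α q₁ T ω - α| + |threshold R γ α q₁ T ω - q₀|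
    ≤ D + (L + 1) * (ε + b + a)} with hgood
  set br : ℕ → Set Ω := fun t =>
    {ω | Jlow t ≤ (selNumber R γ α q₁ t ω : ℤ) ∧ (selNumber R γ α q₁ t ω : ℤ) ≤ Jup t} with hbr
  set dist : ℕ → Set Ω := fun t => {ω | C₁ * Dbar t < benchDist μ R γ α q₁ Pi0 t ω} with hdist
  set dev : ℕ → Set Ω := fun s => {ω | a < |∑ t ∈ Finset.Ico s T,
      stepInside R γ α q₁ t ω * noise μ R γ α q₁ t ω| ∧
    ∑ t ∈ Finset.Ico s T, (stepInside R γ α q₁ t ω) ^ 2 * (selAt R γ α q₁ t ω : ℝ)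
      ≤ b ^ 2 * N} with hdev
  set reg : Set Ω := {ω | ∀ t, 1 ≤ t → ier μ R γ α q₁ t ω ∈ Set.Icc (0 : ℝ) 1} with hreg
  have hregnull : μ.real regᶜ = 0 := by
    have : ∀ᵐ ω ∂μ, ω ∈ reg := by
      rw [hreg]
      simp only [Set.mem_ofPred_eq]
      rw [ae_all_iff]
      intro t
      by_cases ht : 1 ≤ t
      · filter_upwards [ier_mem μ R γ α q₁ ht] with ω h _ using h
      · exact ae_of_all _ fun ω h => absurd h ht
    have hz : μ regᶜ = 0 := mem_ae_iff.mp this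
    rw [measureReal_def, hz, ENNReal.toReal_zero]
  have hcover : (Set.univ : Set Ω) ⊆ good ∪ (⋃ t ∈ Finset.Icc t₀ T, dist t)
      ∪ (⋃ s ∈ Finset.Icc t₀ T, dev s) ∪ (br t₀)ᶜ ∪ (br (T + 1))ᶜ ∪ regᶜ := by
    intro ω _
    by_contra hω
    simp only [Set.mem_union, Set.mem_iUnion, not_or, not_exists, Set.mem_compl_iff, not_not]
      at hω
    obtain ⟨⟨⟨⟨⟨hng, hnd⟩, hns⟩, hbr1⟩, hbr2⟩, hr⟩ := hω
    obtain ⟨h1l, h1u⟩ := hbr1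
    obtain ⟨h2l, h2u⟩ := hbr2
    apply hng
    have hJ0 : (Jlow t₀ : ℝ) ≤ selNumber R γ α q₁ t₀ ω := by exact_mod_cast h1l
    have hJ0' : (selNumber R γ α q₁ t₀ ω : ℝ) ≤ Jup t₀ := by exact_mod_cast h1u
    have hJT : (Jlow (T + 1) : ℝ) ≤ selNumber R γ α q₁ (T + 1) ω := by exact_mod_cast h2l
    have hJT' : (selNumber R γ α q₁ (T + 1) ω : ℝ) ≤ Jup (T + 1) := by exact_mod_cast h2u
    have hJmono : ∀ s t, s ≤ t → (selNumber R γ α q₁ s ω : ℝ) ≤ selNumber R γ α q₁ t ω :=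
      fun s t h => by exact_mod_cast selNumber_mono R γ α q₁ h ω
    have hlast : (selNumber R γ α q₁ (T + 1) ω : ℝ) ≤ selNumber R γ α q₁ T ω + 1 := by
      rw [selNumber_succ R γ α q₁ (ht₀.trans hT)]
      rcases selAt_mem R γ α q₁ (ht₀.trans hT) ω with h | h <;> rw [h] <;> push_cast <;> linarith
    have hDω : ∀ t, t₀ ≤ t → t ≤ T → benchDist μ R γ α q₁ Pi0 t ω ≤ D := fun t h1 h2 =>
      (not_lt.mp (hnd t (Finset.mem_Icc.mpr ⟨h1, h2⟩))).trans (hDbar t h1 h2)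
    have hierω : ∀ t, t₀ ≤ t → ier μ R γ α q₁ t ω = ierTrunc μ R γ α q₁ t ω := fun t h1 => by
      have := hr t (ht₀.trans h1)
      rw [ierTrunc, min_eq_right this.2, max_eq_right this.1]
    have hstep : ∀ t, t₀ ≤ t → γ (selNumber R γ α q₁ t ω) ≤ b := fun t h1 =>
      step_le hc hβ hA (hAJ.trans (hJ0.trans (hJmono _ _ h1)))
    have hnoise : ∀ s, t₀ ≤ s → s ≤ T →
        |∑ t ∈ Finset.Ico s T, stepInside R γ α q₁ t ω * noise μ R γ α q₁ t ω| ≤ a := by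
      intro s h1 h2
      have h3 := hns s (Finset.mem_Icc.mpr ⟨h1, h2⟩)
      by_contra h4
      refine h3 ⟨not_le.mp h4, ?_⟩
      calc _ ≤ ∑ t ∈ Finset.Ico s T, b ^ 2 * (selAt R γ α q₁ t ω : ℝ) := by
            refine Finset.sum_le_sum fun t ht => ?_
            rw [Finset.mem_Ico] at ht
            refine mul_le_mul_of_nonneg_right ?_ (Nat.cast_nonneg _)
            unfold stepInside
            split_ifs
            · exact pow_le_pow_left₀ (hγ0 _) (hstep t (h1.trans ht.1)) 2
            · simpa using sq_nonneg b
        _ = b ^ 2 * (selNumber R γ α q₁ T ω - selNumber R γ α q₁ s ω) := by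
            rw [← Finset.mul_sum, sum_selAt R γ α q₁ (ht₀.trans h1) h2]
        _ ≤ b ^ 2 * N := by
            gcongr
            linarith [hJmono T (T + 1) (by omega), hJmono t₀ s h1]
    have hM : |threshold R γ α q₁ t₀ ω - q₀| ≤ R.B + c := by
      obtain ⟨h1, h2⟩ := threshold_mem R γ α q₁ hα hq₁ hγ0 hγc ht₀ ω
      have := hb.δ_pos
      have := hb.below
      have := hb.above
      exact abs_le.mpr ⟨by linarith, by linarith⟩
    have hpush : R.B + c ≤ κ * ε / 2 * ∑ t ∈ Finset.Ico t₀ T,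
        γ (selNumber R γ α q₁ t ω) * selAt R γ α q₁ t ω := by
      have h1 : Γ ≤ ∑ t ∈ Finset.Ico t₀ T,
          γ (selNumber R γ α q₁ t ω) * selAt R γ α q₁ t ω := by
        calc Γ ≤ (selNumber R γ α q₁ T ω - selNumber R γ α q₁ t₀ ω) * (c * U ^ (-β)) := by
              rw [hΓ]
              gcongr
              linarith
          _ = ∑ t ∈ Finset.Ico t₀ T, c * U ^ (-β) * (selAt R γ α q₁ t ω : ℝ) := by
              rw [← Finset.mul_sum, sum_selAt R γ α q₁ ht₀ hT, mul_comm]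
          _ ≤ _ := by
              refine Finset.sum_le_sum fun t ht => ?_
              rw [Finset.mem_Ico] at ht
              refine mul_le_mul_of_nonneg_right ?_ (Nat.cast_nonneg _)
              exact le_step hc hβ (one_le_selNumber R γ α q₁ t ω)
                ((hJmono t (T + 1) (by omega)).trans (hJT'.trans hUJ))
      have h2 : (R.B + c) / Γ ≤ κ * ε / 2 := by rw [hκε]; linarith
      calc R.B + c = (R.B + c) / Γ * Γ := (div_mul_cancel₀ _ hΓ0.ne').symm
        _ ≤ _ := by gcongr
    have hfinal := abs_threshold_sub_le hb hanti hα ht₀ hT hγ0 hε0 hεδ (by linarith) hεα hεα'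
      hb0.le (by positivity) (fun t h1 _ => hierω t h1) hDω (fun t h1 _ => hstep t h1) hnoise hM
      hpush
    have hier := abs_ier_sub_le hb hα hD0 (hr T (ht₀.trans hT)) (hDω T hT le_rfl)
    have hL := hb.L_pos
    rw [hgood, Set.mem_ofPred_eq]
    have : (L + 1) * |threshold R γ α q₁ T ω - q₀| ≤ (L + 1) * (ε + b + a) := by gcongr
    linarith
  have hdevsum : μ.real (⋃ s ∈ Finset.Icc t₀ T, dev s) ≤ 2 * (1 / T) := by
    have hexp : Real.exp (-(2 * Real.log T)) = 1 / (T : ℝ) ^ 2 := by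
      rw [Real.exp_neg, two_mul, Real.exp_add, Real.exp_log (by linarith), ← sq, one_div]
    calc _ ≤ ∑ s ∈ Finset.Icc t₀ T, μ.real (dev s) := measureReal_biUnion_finset_le _ _
      _ ≤ ∑ s ∈ Finset.Icc t₀ T, 2 * (1 / (T : ℝ) ^ 2) := by
          refine Finset.sum_le_sum fun s hs => ?_
          rw [Finset.mem_Icc] at hs
          rw [← hexp]
          exact (isSelectedNoise μ R γ α q₁ hγ0 hγc (ht₀.trans hs.1)).measure_abs_le_exp hs.2
            (by positivity) hlog
      _ ≤ T * (2 * (1 / (T : ℝ) ^ 2)) := by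
          rw [Finset.sum_const, nsmul_eq_mul, Nat.card_Icc]
          gcongr
          omega
      _ = _ := by field_simp
  have hdistsum : μ.real (⋃ t ∈ Finset.Icc t₀ T, dist t) ≤ ∑ t ∈ Finset.Icc t₀ T, μ.real (dist t) :=
    measureReal_biUnion_finset_le _ _
  have hmeas := measureReal_mono (μ := μ) hcover
  rw [probReal_univ] at hmeas
  have u1 := measureReal_union_le (μ := μ) (good ∪ (⋃ t ∈ Finset.Icc t₀ T, dist t)
      ∪ (⋃ s ∈ Finset.Icc t₀ T, dev s) ∪ (br t₀)ᶜ ∪ (br (T + 1))ᶜ) regᶜ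
  have u2 := measureReal_union_le (μ := μ) (good ∪ (⋃ t ∈ Finset.Icc t₀ T, dist t)
      ∪ (⋃ s ∈ Finset.Icc t₀ T, dev s) ∪ (br t₀)ᶜ) (br (T + 1))ᶜ
  have u3 := measureReal_union_le (μ := μ) (good ∪ (⋃ t ∈ Finset.Icc t₀ T, dist t)
      ∪ (⋃ s ∈ Finset.Icc t₀ T, dev s)) (br t₀)ᶜ
  have u4 := measureReal_union_le (μ := μ) (good ∪ (⋃ t ∈ Finset.Icc t₀ T, dist t))
      (⋃ s ∈ Finset.Icc t₀ T, dev s)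
  have u5 := measureReal_union_le (μ := μ) good (⋃ t ∈ Finset.Icc t₀ T, dist t)
  have hb1 : μ.real (br t₀)ᶜ = _ := bracketFailure_eq γ Jlow Jup ht₀
  have hb2 : μ.real (br (T + 1))ᶜ = _ := bracketFailure_eq γ Jlow Jup (by omega)
  linarith

end Core

end OnlineSCI

namespace OnlineSCI

section Budget

variable {η : ℕ → ℝ}

theorem eta_antitone (hη_anti : ∀ t, 1 ≤ t → η (t + 1) ≤ η t) {s t : ℕ} (hs : 1 ≤ s)
    (hst : s ≤ t) : η t ≤ η s := by
  induction t, hst using Nat.le_induction with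
  | base => exact le_rfl
  | succ t hst ih => exact (hη_anti t (hs.trans hst)).trans ih

theorem sum_budget_le (hη_anti : ∀ t, 1 ≤ t → η (t + 1) ≤ η t) {t₀ : ℕ} (ht₀ : 1 ≤ t₀)
    (T : ℕ) :
    ∑ t ∈ Finset.Icc t₀ T, 6 * η t / (Real.pi ^ 2 * (t : ℝ) ^ 2)
      ≤ η t₀ * (6 / Real.pi ^ 2 * ∑ t ∈ Finset.Icc t₀ T, 1 / (t : ℝ) ^ 2) := by
  rw [Finset.mul_sum, Finset.mul_sum]
  refine Finset.sum_le_sum fun t ht => ?_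
  rw [Finset.mem_Icc] at ht
  have ht1 : (0 : ℝ) < t := by exact_mod_cast ht₀.trans ht.1
  have := eta_antitone hη_anti ht₀ ht.1
  have hpi := Real.pi_pos
  calc _ = η t * (6 / Real.pi ^ 2 * (1 / (t : ℝ) ^ 2)) := by field_simp
    _ ≤ _ := by gcongr

theorem sum_budget_le_start (hη : ∀ t, 1 ≤ t → 0 < η t ∧ η t ≤ 1)
    (hη_anti : ∀ t, 1 ≤ t → η (t + 1) ≤ η t) {t₀ : ℕ} (ht₀ : 1 ≤ t₀) (T : ℕ) :
    ∑ t ∈ Finset.Icc t₀ T, 6 * η t / (Real.pi ^ 2 * (t : ℝ) ^ 2) ≤ η t₀ := by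
  refine (sum_budget_le hη_anti ht₀ T).trans ?_
  have h1 : ∑ t ∈ Finset.Icc t₀ T, 1 / (t : ℝ) ^ 2 ≤ Real.pi ^ 2 / 6 :=
    sum_le_hasSum _ (fun _ _ => by positivity) hasSum_zeta_two
  have hpi := Real.pi_pos
  have h2 : 6 / Real.pi ^ 2 * ∑ t ∈ Finset.Icc t₀ T, 1 / (t : ℝ) ^ 2
      ≤ 6 / Real.pi ^ 2 * (Real.pi ^ 2 / 6) := by gcongr
  have h3 : 6 / Real.pi ^ 2 * (Real.pi ^ 2 / 6) = 1 := by field_simp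
  exact mul_le_of_le_one_right (hη t₀ ht₀).1.le (h2.trans h3.le)

theorem sum_budget_le_tail (hη : ∀ t, 1 ≤ t → 0 < η t ∧ η t ≤ 1)
    (hη_anti : ∀ t, 1 ≤ t → η (t + 1) ≤ η t) {t₀ : ℕ} (ht₀ : 1 ≤ t₀) (T : ℕ) :
    ∑ t ∈ Finset.Icc t₀ T, 6 * η t / (Real.pi ^ 2 * (t : ℝ) ^ 2) ≤ η t₀ * (2 / t₀) := by
  refine (sum_budget_le hη_anti ht₀ T).trans ?_
  have hη0 := (hη t₀ ht₀).1
  gcongr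
  have h1 : ∑ t ∈ Finset.Icc t₀ T, 1 / (t : ℝ) ^ 2 ≤ 2 / (t₀ : ℝ) := by
    have := sum_Ioo_inv_sq_le (α := ℝ) (t₀ - 1) (T + 1)
    rw [Nat.cast_sub ht₀, Nat.cast_one, sub_add_cancel] at this
    refine le_trans (le_of_eq ?_) this
    refine Finset.sum_congr ?_ fun t _ => one_div _
    ext t
    simp only [Finset.mem_Icc, Finset.mem_Ioo]
    omega
  have h2 : 6 / Real.pi ^ 2 ≤ 1 := by
    rw [div_le_one (by positivity)]
    nlinarith [Real.pi_gt_three]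
  have h3 : 0 ≤ ∑ t ∈ Finset.Icc t₀ T, 1 / (t : ℝ) ^ 2 :=
    Finset.sum_nonneg fun _ _ => by positivity
  exact (mul_le_of_le_one_left h3 h2).trans h1

theorem eventually_one_div_le (hη : ∀ t, 1 ≤ t → 0 < η t ∧ η t ≤ 1)
    (hη_log : ∀ᶠ T : ℕ in atTop, Real.log (1 / η T) ≤ Real.log T) :
    ∀ᶠ T : ℕ in atTop, 1 / (T : ℝ) ≤ η T := by
  filter_upwards [hη_log, eventually_ge_atTop 1] with T h hT
  have h0 := (hη T hT).1
  have hT0 : (0 : ℝ) < T := by exact_mod_cast hT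
  have := (Real.log_le_log_iff (by positivity) hT0).mp h
  rwa [one_div_le hT0 h0]

theorem eventually_sum_budget_le (hη : ∀ t, 1 ≤ t → 0 < η t ∧ η t ≤ 1)
    (hη_anti : ∀ t, 1 ≤ t → η (t + 1) ≤ η t)
    (hη_log : ∀ᶠ T : ℕ in atTop, Real.log (1 / η T) ≤ Real.log T) {tT : ℕ → ℕ}
    (htT : Tendsto tT atTop atTop)
    (hO : (fun T : ℕ => (T : ℝ)) =O[atTop] (fun T => (tT T : ℝ))) :
    ∀ᶠ T : ℕ in atTop,
      ∑ t ∈ Finset.Icc (tT T) T, 6 * η t / (Real.pi ^ 2 * (t : ℝ) ^ 2) ≤ η T := by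
  by_cases h : ∃ e > 0, ∀ t, 1 ≤ t → e ≤ η t
  · obtain ⟨e, he, hle⟩ := h
    have hlim : Tendsto (fun T => 2 / (tT T : ℝ)) atTop (nhds 0) :=
      tendsto_const_nhds.div_atTop (tendsto_natCast_atTop_atTop.comp htT)
    filter_upwards [htT.eventually_ge_atTop 1, hlim.eventually_le_const he,
      eventually_ge_atTop 1] with T h1 h2 h3
    have h4 := sum_budget_le_tail hη hη_anti h1 T
    have h5 := hη _ h1
    have h6 : η (tT T) * (2 / (tT T : ℝ)) ≤ 2 / (tT T : ℝ) :=
      mul_le_of_le_one_left (by positivity) h5.2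
    linarith [hle T h3]
  · push Not at h
    obtain ⟨C, hC, hCO⟩ := hO.exists_pos
    obtain ⟨t₁, ht₁, hlt⟩ := h (1 / (2 * C)) (by positivity)
    filter_upwards [htT.eventually_ge_atTop t₁, hCO.bound, eventually_one_div_le hη hη_log,
      eventually_ge_atTop 1] with T h1 h2 h3 h4
    simp only [Real.norm_natCast] at h2
    have h5 := ht₁.trans h1
    have hT0 : (0 : ℝ) < T := by exact_mod_cast h4
    have ht0 : (0 : ℝ) < tT T := by exact_mod_cast h5
    have h6 : 2 / (tT T : ℝ) ≤ 2 * C / T := by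
      rw [div_le_div_iff₀ ht0 hT0]
      linarith
    have h7 := eta_antitone hη_anti ht₁ h1
    calc _ ≤ η (tT T) * (2 / (tT T : ℝ)) := sum_budget_le_tail hη hη_anti h5 T
      _ ≤ 1 / (2 * C) * (2 * C / T) := by
          gcongr
          linarith
      _ = 1 / T := by field_simp
      _ ≤ η T := h3

end Budget

/-- The rate `(log T)^{1/2} G^{1/2} J^{-β} + G^{-1} J^β` for a window with about `G` selections and
selection numbers of order `J`. -/
noncomputable def rhoWindow (β : ℝ) (J G : ℕ → ℝ) (T : ℕ) : ℝ :=
  Real.sqrt (Real.log T) * Real.sqrt (G T) * (J T) ^ (-β) + (G T)⁻¹ * (J T) ^ β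

/-- The window `[t(T), T]` has about `G(T)` selections and selection numbers of order `J(T)`. -/
structure IsWindow (β : ℝ) (Jlow Jup : ℕ → ℤ) (tT : ℕ → ℕ) (J G : ℕ → ℝ) (k K : ℝ) : Prop where
  k_pos : 0 < k
  K_pos : 0 < K
  time_tendsto : Tendsto tT atTop atTop
  time_le : ∀ᶠ T in atTop, tT T ≤ T
  one_le : ∀ᶠ T in atTop, 1 ≤ J T
  gap_pos : ∀ᶠ T in atTop, 0 < G T
  low : ∀ᶠ T in atTop, k * J T ≤ Jlow (tT T)
  up : ∀ᶠ T in atTop, (Jup (T + 1) : ℝ) ≤ K * J T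
  gap_low : ∀ᶠ T in atTop, k * G T ≤ Jlow (T + 1) - 1 - Jup (tT T)
  gap_up : ∀ᶠ T in atTop, (Jup (T + 1) : ℝ) - Jlow (tT T) ≤ K * G T
  gap_le : ∀ᶠ T in atTop, G T ≤ K * J T
  tendsto : Tendsto (fun T => (G T)⁻¹ * (J T) ^ β) atTop (nhds 0)

theorem IsWindow.rhoWindow_nonneg {β : ℝ} {Jlow Jup : ℕ → ℤ} {tT : ℕ → ℕ} {J G : ℕ → ℝ}
    {k K : ℝ} (h : IsWindow β Jlow Jup tT J G k K) : ∀ᶠ T in atTop, 0 ≤ rhoWindow β J G T := by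
  filter_upwards [h.one_le, h.gap_pos] with T h1 h2
  unfold rhoWindow
  positivity

theorem eventually_antitone {f : ℕ → ℝ} (h : ∀ᶠ t in atTop, f (t + 1) ≤ f t) :
    ∃ N, ∀ s t, N ≤ s → s ≤ t → f t ≤ f s := by
  obtain ⟨N, hN⟩ := eventually_atTop.mp h
  refine ⟨N, fun s t hs hst => ?_⟩
  induction t, hst using Nat.le_induction with
  | base => exact le_rfl
  | succ t hst ih => exact (hN t (hs.trans hst)).trans ih

theorem eventually_nonneg_of_antitone {f : ℕ → ℝ} (h : ∀ᶠ t in atTop, f (t + 1) ≤ f t)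
    (h0 : Tendsto f atTop (nhds 0)) : ∀ᶠ t in atTop, 0 ≤ f t := by
  obtain ⟨N, hN⟩ := eventually_antitone h
  filter_upwards [eventually_ge_atTop N] with s hs
  refine le_of_tendsto h0 ?_
  filter_upwards [eventually_ge_atTop s] with t ht using hN s t hs ht

/-- A selection number of order `J` makes the step `J^{-β}` negligible against the rate. -/
theorem rpow_neg_le_window {β J G K : ℝ} (hβ : 1 / 2 < β) (hJ : 1 ≤ J) (hG : 0 < G)
    (hGJ : G ≤ K * J) (hK : 0 < K) : J ^ (-β) ≤ K * (G⁻¹ * J ^ β) := by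
  have hJ0 : 0 < J := by linarith
  have h1 : J * J ^ (-β) ≤ J ^ β := by
    calc J * J ^ (-β) = J ^ (1 - β) := by
          rw [sub_eq_add_neg, Real.rpow_add hJ0, Real.rpow_one]
      _ ≤ J ^ β := Real.rpow_le_rpow_of_exponent_le hJ (by linarith)
  have h2 : 0 < J ^ (-β) := Real.rpow_pos_of_pos hJ0 _
  calc J ^ (-β) = G⁻¹ * (G * J ^ (-β)) := by field_simp
    _ ≤ G⁻¹ * (K * J * J ^ (-β)) := by gcongr
    _ = K * (G⁻¹ * (J * J ^ (-β))) := by ring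
    _ ≤ K * (G⁻¹ * J ^ β) := by gcongr

section Rate

variable {Ω 𝒳 𝒴 : Type*} [m0 : MeasurableSpace Ω] [MeasurableSpace 𝒳] [MeasurableSpace 𝒴]
  {μ : Measure Ω} {P : DataStream Ω 𝒳 𝒴} {R : Rules P}
  {α q₁ q₀ c β : ℝ} {Pi0 : ℝ → ℝ}

theorem hasRate_of_eventually {γ : ℕ → ℝ} {Jlow Jup : ℕ → ℤ} {tT : ℕ → ℕ} {η rate : ℕ → ℝ}
    {C₀ : ℝ} (hC₀ : 0 < C₀)
    (h : ∀ᶠ T in atTop, 1 - 3 * η T - bracketFailure μ R γ α q₁ Jlow Jup (tT T)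
        - bracketFailure μ R γ α q₁ Jlow Jup (T + 1)
      ≤ μ.real {ω | |ier μ R γ α q₁ T ω - α| + |threshold R γ α q₁ T ω - q₀| ≤ C₀ * rate T}) :
    HasRate μ R γ α q₁ q₀ Jlow Jup tT η rate := by
  obtain ⟨N, hN⟩ := eventually_atTop.mp h
  exact ⟨max 1 N, C₀, le_max_left _ _, hC₀, fun T hT => hN T ((le_max_right _ _).trans hT)⟩

theorem HasRate.mono [IsProbabilityMeasure μ] {γ : ℕ → ℝ} {Jlow Jup : ℕ → ℤ} {tT : ℕ → ℕ}
    {η rate rate' : ℕ → ℝ} (h : HasRate μ R γ α q₁ q₀ Jlow Jup tT η rate) {C : ℝ} (hC : 0 < C)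
    (hle : ∀ᶠ T in atTop, rate T ≤ C * rate' T) :
    HasRate μ R γ α q₁ q₀ Jlow Jup tT η rate' := by
  obtain ⟨T₀, C₀, -, hC₀, hT⟩ := h
  refine hasRate_of_eventually (C₀ := C₀ * C) (by positivity) ?_
  filter_upwards [hle, eventually_ge_atTop T₀] with T h1 h2
  refine (hT T h2).trans (measureReal_mono fun ω hω => ?_)
  have hω' : |ier μ R γ α q₁ T ω - α| + |threshold R γ α q₁ T ω - q₀| ≤ C₀ * rate T := hω
  refine hω'.trans ?_
  rw [mul_assoc]
  gcongr

/-- Replacing `Dbar (t(T))` by `Dbar T` in the rate. -/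
theorem HasRate.of_isBigO [IsProbabilityMeasure μ] {γ : ℕ → ℝ} {Jlow Jup : ℕ → ℤ} {tT : ℕ → ℕ}
    {η ρ Dbar : ℕ → ℝ}
    (h : HasRate μ R γ α q₁ q₀ Jlow Jup tT η (fun T => ρ T + Dbar (tT T)))
    (hρ : ∀ᶠ T in atTop, 0 ≤ ρ T) (hD : ∀ᶠ T in atTop, 0 ≤ Dbar T)
    (hO : (fun T => Dbar (tT T)) =O[atTop] (fun T => ρ T + Dbar T)) :
    HasRate μ R γ α q₁ q₀ Jlow Jup tT η (fun T => ρ T + Dbar T) := by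
  obtain ⟨C, hC, hCO⟩ := hO.exists_pos
  refine h.mono (C := 1 + C) (by positivity) ?_
  filter_upwards [hρ, hD, hCO.bound] with T h1 h2 h3
  rw [Real.norm_of_nonneg (add_nonneg h1 h2)] at h3
  have := (le_abs_self _).trans h3
  linarith

theorem hasRate_of_window [IsProbabilityMeasure μ] (hα : α ∈ Set.Ioo (0 : ℝ) 1) (hc : 0 < c)
    (hβ : β ∈ Set.Ioo (1 / 2 : ℝ) 1) (hq₁ : q₁ ∈ Set.Icc 0 R.B)
    (hPi0 : IsBenchmark R.B α q₀ Pi0) {Dbar η η' : ℕ → ℝ} {C₁ : ℝ} (hC₁ : 0 < C₁)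
    (hDbar_tendsto : Tendsto Dbar atTop (nhds 0))
    (hDbar_anti : ∀ᶠ t in atTop, Dbar (t + 1) ≤ Dbar t)
    (hD : ∀ t : ℕ, 1 ≤ t → μ.real {ω | C₁ * Dbar t < benchDist μ R (step c β) α q₁ Pi0 t ω}
        ≤ 6 * η t / (Real.pi ^ 2 * (t : ℝ) ^ 2))
    {Jlow Jup : ℕ → ℤ} {tT : ℕ → ℕ} {J G : ℕ → ℝ} {k K : ℝ}
    (hw : IsWindow β Jlow Jup tT J G k K)
    (hη'_sum : ∀ᶠ T in atTop,
      ∑ t ∈ Finset.Icc (tT T) T, 6 * η t / (Real.pi ^ 2 * (t : ℝ) ^ 2) ≤ η' T)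
    (hη'_ge : ∀ᶠ T : ℕ in atTop, 1 / (T : ℝ) ≤ η' T) :
    HasRate μ R (step c β) α q₁ q₀ Jlow Jup tT η'
      (fun T => rhoWindow β J G T + Dbar (tT T)) := by
  obtain ⟨δ, κ, L, hb⟩ := hPi0.exists_bounds
  have hk := hw.k_pos
  have hK := hw.K_pos
  have hκ := hb.κ_pos
  have hL := hb.L_pos
  have hB := R.B_pos
  have hβ0 : 0 < β := by linarith [hβ.1]
  set E₁ := (R.B + c) * K ^ β / (k * c) with hE₁
  set E₂ := c * k ^ (-β) with hE₂
  set E₃ := c * k ^ (-β) * Real.sqrt (2 * K) with hE₃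
  have hE₁0 : 0 < E₁ := by positivity
  have hE₂0 : 0 < E₂ := by positivity
  have hE₃0 : 0 < E₃ := by positivity
  set εf : ℕ → ℝ := fun T => 2 / κ * (C₁ * Dbar (tT T) + E₁ * ((G T)⁻¹ * (J T) ^ β)) with hεf
  have hεlim : Tendsto εf atTop (nhds 0) := by
    have h1 := (hDbar_tendsto.comp hw.time_tendsto).const_mul C₁
    have h2 := (h1.add (hw.tendsto.const_mul E₁)).const_mul (2 / κ)
    simpa using h2
  have hεsmall : ∀ {e : ℝ}, 0 < e → ∀ᶠ T in atTop, εf T ≤ e := fun he =>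
    hεlim.eventually_le_const he
  obtain ⟨N, hN⟩ := eventually_antitone hDbar_anti
  have hDnonneg := hw.time_tendsto.eventually (eventually_nonneg_of_antitone hDbar_anti
    hDbar_tendsto)
  refine hasRate_of_eventually
    (C₀ := C₁ + (L + 1) * (2 / κ * C₁ + 2 / κ * E₁ + E₂ * K + 2 * E₃)) (by positivity) ?_
  filter_upwards [hw.time_tendsto.eventually_ge_atTop (max 1 N), hw.time_le, hw.one_le, hw.gap_pos,
    hw.low, hw.up, hw.gap_low, hw.gap_up, hw.gap_le, hDnonneg, hεsmall hb.δ_pos,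
    hεsmall (e := 2 * α / κ) (by have := hα.1; positivity),
    hεsmall (e := 2 * (1 - α) / κ) (by have : 0 < 1 - α := by linarith [hα.2]
                                       positivity), hη'_sum, hη'_ge]
    with T ht₀ htT hJ1 hG hlow hup hglow hgup hgle hDn hε1 hε2 hε3 hsum hge
  have ht1 : 1 ≤ tT T := (le_max_left _ _).trans ht₀
  have hJ0 : 0 < J T := by linarith
  set y := (G T)⁻¹ * (J T) ^ β with hy
  set x := Real.sqrt (Real.log T) * Real.sqrt (G T) * (J T) ^ (-β) with hx
  have hεeq : εf T = 2 / κ * (C₁ * Dbar (tT T)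
      + (R.B + c) / (k * G T * (c * (K * J T) ^ (-β)))) := by
    have : (R.B + c) / (k * G T * (c * (K * J T) ^ (-β))) = E₁ * y := by
      rw [Real.mul_rpow hK.le hJ0.le, Real.rpow_neg hK.le, Real.rpow_neg hJ0.le, hE₁, hy]
      field_simp
    rw [this]
  have hmain := measure_window_ge (μ := μ) hb hPi0.antitone hα hc hβ0 hq₁ (Jlow := Jlow)
    (Jup := Jup) ht1 htT (Dbar := Dbar) (C₁ := C₁) (mul_nonneg hC₁.le hDn)
    (fun t h1 _ => mul_le_mul_of_nonneg_left
      (hN _ t ((le_max_right _ _).trans ht₀) h1) hC₁.le)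
    (mul_pos hk hJ0) hlow (mul_pos hK hJ0) hup (mul_pos hk hG) hglow (mul_pos hK hG) hgup hεeq hε1
    (by rwa [le_div_iff₀' hκ] at hε2) (by rwa [le_div_iff₀' hκ] at hε3)
  have hsum' : ∑ t ∈ Finset.Icc (tT T) T,
      μ.real {ω | C₁ * Dbar t < benchDist μ R (step c β) α q₁ Pi0 t ω} ≤ η' T :=
    (Finset.sum_le_sum fun t ht => hD t (ht1.trans (Finset.mem_Icc.mp ht).1)).trans hsum
  refine le_trans (by linarith) (hmain.trans (measureReal_mono fun ω hω => ?_))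
  have hω' : |ier μ R (step c β) α q₁ T ω - α| + |threshold R (step c β) α q₁ T ω - q₀| ≤ _ := hω
  refine hω'.trans ?_
  have hlogT : 0 ≤ Real.log T := Real.log_natCast_nonneg T
  have hbE : c * (k * J T) ^ (-β) = E₂ * (J T) ^ (-β) := by
    rw [Real.mul_rpow hk.le hJ0.le, hE₂]; ring
  have hby : E₂ * (J T) ^ (-β) ≤ E₂ * (K * y) :=
    mul_le_mul_of_nonneg_left (rpow_neg_le_window hβ.1 hJ1 hG hgle hK) hE₂0.le
  have hax : Real.sqrt (2 * Real.log T * ((c * (k * J T) ^ (-β)) ^ 2 * (K * G T))) = E₃ * x := by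
    have e : 2 * Real.log T * ((c * (k * J T) ^ (-β)) ^ 2 * (K * G T))
        = (E₂ * (J T) ^ (-β)) ^ 2 * (2 * K * (Real.log T * G T)) := by rw [hbE]; ring
    rw [e, Real.sqrt_mul (sq_nonneg _), Real.sqrt_sq (by positivity),
      Real.sqrt_mul (by positivity), Real.sqrt_mul hlogT, hE₃, hx, hE₂]
    ring
  have hx0 : 0 ≤ x := by positivity
  have hy0 : 0 ≤ y := by positivity
  have hd0 : 0 ≤ Dbar (tT T) := hDn
  rw [hax, hbE]
  have hρ : rhoWindow β J G T = x + y := rfl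
  simp only [hρ]
  set d := Dbar (tT T)
  have h1 : C₁ * d ≤ C₁ * (x + y + d) := by gcongr; linarith
  have hκ2 : 0 < 2 / κ := by positivity
  have h2 : εf T + E₂ * (J T) ^ (-β) + 2 * (E₃ * x)
      ≤ (2 / κ * C₁ + 2 / κ * E₁ + E₂ * K + 2 * E₃) * (x + y + d) := by
    have : εf T = 2 / κ * C₁ * d + 2 / κ * E₁ * y := by rw [hεf]; ring
    rw [this]
    have i1 : 2 / κ * C₁ * d ≤ 2 / κ * C₁ * (x + y + d) := by gcongr; linarith
    have i2 : 2 / κ * E₁ * y ≤ 2 / κ * E₁ * (x + y + d) := by gcongr; linarith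
    have i3 : E₂ * K * y ≤ E₂ * K * (x + y + d) := by gcongr; linarith
    have i4 : 2 * E₃ * x ≤ 2 * E₃ * (x + y + d) := by gcongr; linarith
    linarith
  have h3 := mul_le_mul_of_nonneg_left h2 (by linarith : 0 ≤ L + 1)
  linarith

end Rate

end OnlineSCI

namespace OnlineSCI

section Linear

variable {r : ℝ} {Jlow Jup : ℕ → ℤ} {tT : ℕ → ℕ}

theorem abs_sub_le_of_isEquivalent {u v : ℕ → ℝ} (h : u ~[atTop] v) {e : ℝ} (he : 0 < e) :
    ∀ᶠ T in atTop, |u T - v T| ≤ e * |v T| := by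
  simpa [Real.norm_eq_abs] using h.isLittleO.def he

theorem eventually_floor_ge (hr : 0 < r) (htT : ∀ T : ℕ, tT T = ⌊r * (T : ℝ) / 2⌋₊) :
    ∀ᶠ T : ℕ in atTop, r * (T : ℝ) / 4 ≤ tT T := by
  filter_upwards [tendsto_natCast_atTop_atTop.eventually_ge_atTop (4 / r)] with T hT
  rw [div_le_iff₀ hr] at hT
  have := Nat.lt_floor_add_one (r * (T : ℝ) / 2)
  rw [htT]
  linarith

theorem tendsto_floor (hr : 0 < r) (htT : ∀ T : ℕ, tT T = ⌊r * (T : ℝ) / 2⌋₊) :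
    Tendsto tT atTop atTop := by
  rw [← tendsto_natCast_atTop_iff (R := ℝ)]
  refine tendsto_atTop_mono' atTop (eventually_floor_ge hr htT) ?_
  exact (tendsto_natCast_atTop_atTop.const_mul_atTop hr).atTop_div_const (by norm_num)

theorem isBigO_floor (hr : 0 < r) (htT : ∀ T : ℕ, tT T = ⌊r * (T : ℝ) / 2⌋₊) :
    (fun T : ℕ => (T : ℝ)) =O[atTop] (fun T => (tT T : ℝ)) := by
  refine IsBigO.of_bound (4 / r) ?_
  filter_upwards [eventually_floor_ge hr htT] with T hT
  rw [Real.norm_natCast, Real.norm_natCast]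
  calc (T : ℝ) = 4 / r * (r * T / 4) := by field_simp
    _ ≤ _ := by gcongr

theorem isWindow_linear {β : ℝ} (hβ : β < 1) (hr : 0 < r) (hr1 : r ≤ 1)
    (hlow : (fun T : ℕ => (Jlow T : ℝ)) ~[atTop] (fun T : ℕ => r * (T : ℝ)))
    (hup : ∀ T, 1 ≤ T → Jup T = (T : ℤ))
    (htT : ∀ T : ℕ, tT T = ⌊r * (T : ℝ) / 2⌋₊) :
    IsWindow β Jlow Jup tT (fun T => (T : ℝ)) (fun T => (T : ℝ)) (r ^ 2 / 8) 2 := by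
  have htend := tendsto_floor hr htT
  have hJ : ∀ᶠ T : ℕ in atTop, 3 / 4 * (r * T) ≤ Jlow T := by
    filter_upwards [abs_sub_le_of_isEquivalent hlow (e := 1 / 4) (by norm_num)] with T hT
    rw [abs_of_nonneg (by positivity : 0 ≤ r * (T : ℝ))] at hT
    linarith [(abs_le.mp hT).1]
  have hJt : ∀ᶠ T : ℕ in atTop, r ^ 2 / 8 * (T : ℝ) ≤ Jlow (tT T) := by
    filter_upwards [htend.eventually hJ, eventually_floor_ge hr htT] with T h1 h2
    have h3 : r * (r * (T : ℝ) / 4) ≤ r * tT T := by gcongr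
    have h4 : 0 ≤ r ^ 2 * (T : ℝ) := by positivity
    linarith
  have hupT : ∀ T : ℕ, ((Jup (T + 1) : ℤ) : ℝ) = T + 1 := fun T => by
    rw [hup (T + 1) (by omega)]; push_cast; ring
  refine ⟨by positivity, by norm_num, htend, .of_forall fun T => ?_, ?_, ?_, hJt, ?_, ?_, ?_,
    .of_forall fun T => ?_, ?_⟩
  · rw [htT]
    refine Nat.floor_le_of_le ?_
    have : r * (T : ℝ) ≤ 1 * T := by gcongr
    have : (0 : ℝ) ≤ T := Nat.cast_nonneg T
    linarith
  · filter_upwards [eventually_ge_atTop 1] with T hT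
    exact_mod_cast hT
  · filter_upwards [eventually_ge_atTop 1] with T hT
    exact_mod_cast hT
  · filter_upwards [eventually_ge_atTop 1] with T hT
    have : (1 : ℝ) ≤ T := by exact_mod_cast hT
    rw [hupT]
    linarith
  · filter_upwards [(tendsto_add_atTop_nat 1).eventually hJ, htend.eventually_ge_atTop 1,
      tendsto_natCast_atTop_atTop.eventually_ge_atTop (8 / r)] with T h1 h2 h3
    rw [div_le_iff₀ hr] at h3
    rw [hup _ h2]
    push_cast at h1 ⊢
    have h4 : (tT T : ℝ) ≤ r * T / 2 := by
      rw [htT]; exact Nat.floor_le (by positivity)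
    have h5 : r ^ 2 * (T : ℝ) ≤ r * T := by
      have : r ^ 2 ≤ r := by nlinarith
      gcongr
    linarith
  · filter_upwards [hJt, eventually_ge_atTop 1] with T h1 hT
    have : (1 : ℝ) ≤ T := by exact_mod_cast hT
    rw [hupT]
    have : 0 ≤ r ^ 2 / 8 * (T : ℝ) := by positivity
    linarith
  · have : (0 : ℝ) ≤ T := Nat.cast_nonneg T
    linarith
  · have h1 : Tendsto (fun T : ℕ => (T : ℝ) ^ (-(1 - β))) atTop (nhds 0) :=
      (tendsto_rpow_neg_atTop (by linarith)).comp tendsto_natCast_atTop_atTop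
    refine h1.congr' ?_
    filter_upwards [eventually_ge_atTop 1] with T hT
    have hT0 : (0 : ℝ) < T := by exact_mod_cast hT
    rw [neg_sub, sub_eq_neg_add, Real.rpow_add hT0, Real.rpow_neg_one]

theorem rhoWindow_linear (β : ℝ) {T : ℕ} (hT : 1 ≤ T) :
    rhoWindow β (fun T => (T : ℝ)) (fun T => (T : ℝ)) T = rhoLinear β T := by
  have hT0 : (0 : ℝ) < T := by exact_mod_cast hT
  rw [rhoWindow, rhoLinear, Real.sqrt_eq_rpow (T : ℝ), mul_assoc, ← Real.rpow_add hT0,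
    ← sub_eq_add_neg, ← Real.rpow_neg_one, ← Real.rpow_add hT0, neg_add_eq_sub]

end Linear

theorem tendsto_up_of_gap {Jlow Jup : ℕ → ℤ} {tT : ℕ → ℕ}
    (mono_up : ∀ᶠ t in atTop, Jup t ≤ Jup (t + 1))
    (gap_tendsto : Tendsto (gap Jlow Jup tT) atTop atTop)
    (gap_lt_up : gap Jlow Jup tT =o[atTop] (fun T : ℕ => (Jup T : ℝ))) :
    Tendsto (fun T => (Jup T : ℝ)) atTop atTop := by
  obtain ⟨N, hN⟩ := eventually_antitone (f := fun t => -(Jup t : ℝ)) (by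
    filter_upwards [mono_up] with t ht
    have : (Jup t : ℝ) ≤ Jup (t + 1) := by exact_mod_cast ht
    linarith)
  refine tendsto_atTop_mono' atTop ?_ gap_tendsto
  filter_upwards [gap_lt_up.def one_pos, eventually_ge_atTop N,
    gap_tendsto.eventually_gt_atTop (-(Jup N : ℝ)), gap_tendsto.eventually_ge_atTop 0]
    with T h1 h2 h3 h4
  rw [Real.norm_of_nonneg h4, one_mul, Real.norm_eq_abs] at h1
  have h5 := hN N T le_rfl h2
  rcases le_abs.mp h1 with h | h
  · exact h
  · linarith

theorem IsConcRegime.isWindow {β : ℝ} {Jlow Jup : ℕ → ℤ} {tT : ℕ → ℕ}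
    (h : IsConcRegime β Jlow Jup tT) :
    IsWindow β Jlow Jup tT (fun T => (Jup T : ℝ)) (gap Jlow Jup tT) (1 / 2) 2 := by
  have hJ := tendsto_up_of_gap h.mono_up h.gap_tendsto h.gap_lt_up
  obtain ⟨N, hN⟩ := eventually_antitone (f := fun t => -(Jup t : ℝ)) (by
    filter_upwards [h.mono_up] with t ht
    have : (Jup t : ℝ) ≤ Jup (t + 1) := by exact_mod_cast ht
    linarith)
  refine ⟨by norm_num, by norm_num, h.time_tendsto, h.time_lt.mono fun _ h => h.le,
    hJ.eventually_ge_atTop 1, h.gap_tendsto.eventually_gt_atTop 0, ?_, ?_, ?_, ?_, ?_, ?_⟩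
  · filter_upwards [abs_sub_le_of_isEquivalent h.low_up (e := 1 / 2) (by norm_num),
      eventually_ge_atTop N, hJ.eventually_ge_atTop 0] with T h1 h2 h3
    have h4 := hN T (T + 1) h2 (by omega)
    rw [abs_of_nonneg (by linarith : 0 ≤ (Jup (T + 1) : ℝ))] at h1
    linarith [(abs_le.mp h1).1]
  · filter_upwards [abs_sub_le_of_isEquivalent h.up_up (e := 1) (by norm_num),
      h.time_tendsto.eventually_ge_atTop N, h.time_lt,
      (hJ.comp h.time_tendsto).eventually_ge_atTop 0] with T h1 h2 h3 h4
    have h5 := hN (tT T) T h2 h3.le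
    have h6 : 0 ≤ (Jup (tT T) : ℝ) := h4
    rw [abs_of_nonneg h6] at h1
    linarith [(abs_le.mp h1).2]
  · filter_upwards [h.gap_tendsto.eventually_ge_atTop 2] with T h1
    have : gap Jlow Jup tT T = Jlow (T + 1) - Jup (tT T) := by rw [gap]; push_cast; ring
    linarith
  · filter_upwards [abs_sub_le_of_isEquivalent h.gap_equiv.symm (e := 1) (by norm_num),
      h.gap_tendsto.eventually_ge_atTop 0] with T h1 h2
    rw [abs_of_nonneg h2] at h1
    linarith [(abs_le.mp h1).2]
  · filter_upwards [h.gap_lt_up.def one_pos, h.gap_tendsto.eventually_ge_atTop 0,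
      hJ.eventually_ge_atTop 0] with T h1 h2 h3
    rw [Real.norm_of_nonneg h2, Real.norm_of_nonneg h3] at h1
    linarith
  · refine h.pow_lt_gap.tendsto_div_nhds_zero.congr fun T => ?_
    rw [div_eq_mul_inv, mul_comm]

section Degenerate

variable {Ω 𝒳 𝒴 : Type*} [MeasurableSpace Ω] [MeasurableSpace 𝒳] [MeasurableSpace 𝒴]
  {μ : Measure Ω} [IsProbabilityMeasure μ] {P : DataStream Ω 𝒳 𝒴} {R : Rules P}

/-- A lower bracket that grows faster than `T` fails, since there are at most `T` selections. -/
theorem hasRate_of_one_lt {γ : ℕ → ℝ} {α q₁ q₀ r : ℝ} {Jlow Jup : ℕ → ℤ} {tT : ℕ → ℕ}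
    {η : ℕ → ℝ} (rate : ℕ → ℝ) (hη : ∀ t, 1 ≤ t → 0 < η t ∧ η t ≤ 1) (hr : 1 < r)
    (hlow : (fun T : ℕ => (Jlow T : ℝ)) ~[atTop] (fun T : ℕ => r * (T : ℝ))) :
    HasRate μ R γ α q₁ q₀ Jlow Jup tT η rate := by
  have hr0 : 0 < r := by linarith
  have hJ : ∀ᶠ T : ℕ in atTop, (r + 1) / 2 * T ≤ Jlow T := by
    have he : 0 < (r - 1) / (2 * r) := div_pos (by linarith) (by linarith)
    filter_upwards [abs_sub_le_of_isEquivalent hlow he] with T hT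
    rw [abs_of_nonneg (by positivity : 0 ≤ r * (T : ℝ))] at hT
    have e : (r - 1) / (2 * r) * (r * T) = (r - 1) / 2 * (T : ℝ) := by field_simp
    rw [e] at hT
    linarith [(abs_le.mp hT).1]
  refine hasRate_of_eventually one_pos ?_
  filter_upwards [(tendsto_add_atTop_nat 1).eventually hJ, eventually_ge_atTop 1] with T h1 hT
  have hempty : {ω | Jlow (T + 1) ≤ (selNumber R γ α q₁ (T + 1) ω : ℤ) ∧
      (selNumber R γ α q₁ (T + 1) ω : ℤ) ≤ Jup (T + 1)} = ∅ := by
    rw [Set.eq_empty_iff_forall_notMem]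
    rintro ω ⟨h2, -⟩
    have h3 : (selNumber R γ α q₁ (T + 1) ω : ℝ) ≤ (T + 1 : ℕ) := by
      exact_mod_cast selNumber_le R γ α q₁ (by omega) ω
    have h4 : (Jlow (T + 1) : ℝ) ≤ selNumber R γ α q₁ (T + 1) ω := by exact_mod_cast h2
    have h5 : (0 : ℝ) < (T + 1 : ℕ) := by positivity
    nlinarith
  have hfail : bracketFailure μ R γ α q₁ Jlow Jup (T + 1) = 1 := by
    rw [bracketFailure, hempty]; simp
  have hnonneg : 0 ≤ bracketFailure μ R γ α q₁ Jlow Jup (tT T) :=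
    sub_nonneg.mpr measureReal_le_one
  rw [hfail]
  linarith [(hη T hT).1, measureReal_nonneg (μ := μ) (s := {ω | |ier μ R γ α q₁ T ω - α|
    + |threshold R γ α q₁ T ω - q₀| ≤ 1 * rate T})]

end Degenerate

end OnlineSCI

theorem mainTheorem3 {Ω 𝒳 𝒴 : Type*} [MeasurableSpace Ω] [MeasurableSpace 𝒳] [MeasurableSpace 𝒴]
    (μ : Measure Ω) [IsProbabilityMeasure μ]
    (P : OnlineSCI.DataStream Ω 𝒳 𝒴) (R : OnlineSCI.Rules P)
    (α c β q₁ q₀ : ℝ) (hα : α ∈ Set.Ioo (0 : ℝ) 1) (hc : 0 < c)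
    (hβ : β ∈ Set.Ioo (1 / 2 : ℝ) 1) (hq₁ : q₁ ∈ Set.Icc 0 R.B)
    (Pi0 : ℝ → ℝ) (hPi0 : OnlineSCI.IsBenchmark R.B α q₀ Pi0)
    (Dbar η : ℕ → ℝ) (C₁ : ℝ) (hC₁ : 0 < C₁)
    (hDbar_tendsto : Tendsto Dbar atTop (nhds 0))
    (hDbar_anti : ∀ᶠ t in atTop, Dbar (t + 1) ≤ Dbar t)
    (hη : ∀ t, 1 ≤ t → 0 < η t ∧ η t ≤ 1)
    (hη_anti : ∀ t, 1 ≤ t → η (t + 1) ≤ η t)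
    (hη_log : ∀ᶠ T : ℕ in atTop, Real.log (1 / η T) ≤ Real.log T)
    (hD : ∀ t : ℕ, 1 ≤ t →
      μ.real {ω | C₁ * Dbar t < OnlineSCI.benchDist μ R (OnlineSCI.step c β) α q₁ Pi0 t ω}
        ≤ 6 * η t / (Real.pi ^ 2 * (t : ℝ) ^ 2)) :
    -- linear lower bracket
    (∀ (r : ℝ) (Jlow Jup : ℕ → ℤ) (tT : ℕ → ℕ), 0 < r →
      (fun T : ℕ => (Jlow T : ℝ)) ~[atTop] (fun T : ℕ => r * (T : ℝ)) →
      (∀ T, 1 ≤ T → Jup T = (T : ℤ)) →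
      (∀ T : ℕ, tT T = ⌊r * (T : ℝ) / 2⌋₊) →
      OnlineSCI.HasRate μ R (OnlineSCI.step c β) α q₁ q₀ Jlow Jup tT η
        (fun T => OnlineSCI.rhoLinear β T + Dbar (tT T)) ∧
      ((fun T => Dbar (tT T)) =O[atTop] (fun T => OnlineSCI.rhoLinear β T + Dbar T) →
        OnlineSCI.HasRate μ R (OnlineSCI.step c β) α q₁ q₀ Jlow Jup tT η
          (fun T => OnlineSCI.rhoLinear β T + Dbar T))) ∧
    -- concentration regime
    (∀ (Jlow Jup : ℕ → ℤ) (tT : ℕ → ℕ), OnlineSCI.IsConcRegime β Jlow Jup tT →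
      OnlineSCI.HasRate μ R (OnlineSCI.step c β) α q₁ q₀ Jlow Jup tT (fun T => η (tT T))
        (fun T => OnlineSCI.rhoConc β Jlow Jup tT T + Dbar (tT T)) ∧
      ((fun T : ℕ => (T : ℝ)) =O[atTop] (fun T => (tT T : ℝ)) →
        OnlineSCI.HasRate μ R (OnlineSCI.step c β) α q₁ q₀ Jlow Jup tT η
          (fun T => OnlineSCI.rhoConc β Jlow Jup tT T + Dbar (tT T)) ∧
        ((fun T => Dbar (tT T)) =O[atTop]
            (fun T => OnlineSCI.rhoConc β Jlow Jup tT T + Dbar T) →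
          OnlineSCI.HasRate μ R (OnlineSCI.step c β) α q₁ q₀ Jlow Jup tT η
            (fun T => OnlineSCI.rhoConc β Jlow Jup tT T + Dbar T)))) := by
  have hDnonneg := OnlineSCI.eventually_nonneg_of_antitone hDbar_anti hDbar_tendsto
  have hηinv := OnlineSCI.eventually_one_div_le hη hη_log
  refine ⟨fun r Jlow Jup tT hr hlow hup htT => ?_, fun Jlow Jup tT hreg => ?_⟩
  · rcases lt_or_ge 1 r with hr1 | hr1
    · exact ⟨OnlineSCI.hasRate_of_one_lt _ hη hr1 hlow,
        fun _ => OnlineSCI.hasRate_of_one_lt _ hη hr1 hlow⟩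
    have hw := OnlineSCI.isWindow_linear hβ.2 hr hr1 hlow hup htT
    have hrate := (OnlineSCI.hasRate_of_window hα hc hβ hq₁ hPi0 hC₁ hDbar_tendsto hDbar_anti hD hw
      (OnlineSCI.eventually_sum_budget_le hη hη_anti hη_log hw.time_tendsto
        (OnlineSCI.isBigO_floor hr htT)) hηinv).mono
      (rate' := fun T => OnlineSCI.rhoLinear β T + Dbar (tT T)) one_pos (by
        filter_upwards [eventually_ge_atTop 1] with T hT
        rw [OnlineSCI.rhoWindow_linear β hT, one_mul])
    refine ⟨hrate, fun hO => hrate.of_isBigO ?_ hDnonneg hO⟩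
    exact .of_forall fun T => by unfold OnlineSCI.rhoLinear; positivity
  · have hw := hreg.isWindow
    refine ⟨?_, fun hO => ?_⟩
    · refine OnlineSCI.hasRate_of_window hα hc hβ hq₁ hPi0 hC₁ hDbar_tendsto hDbar_anti hD hw ?_ ?_
      · filter_upwards [hw.time_tendsto.eventually_ge_atTop 1] with T hT
        exact OnlineSCI.sum_budget_le_start hη hη_anti hT T
      · filter_upwards [hηinv, hw.time_tendsto.eventually_ge_atTop 1, hw.time_le] with T h1 h2 h3
        exact h1.trans (OnlineSCI.eta_antitone hη_anti h2 h3)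
    · have hrate := OnlineSCI.hasRate_of_window hα hc hβ hq₁ hPi0 hC₁ hDbar_tendsto hDbar_anti hD hw
        (OnlineSCI.eventually_sum_budget_le hη hη_anti hη_log hw.time_tendsto hO) hηinv
      exact ⟨hrate, fun hO' => hrate.of_isBigO hw.rhoWindow_nonneg hDnonneg hO'⟩
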